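/- **Setting.** All outcomes are $\pm1$ and all numbers of settings are finite. A behaviour of $N$ parties is a tensor $P(\vec a|\vec x)$; it is *quantum* if $P(\vec a|\vec x)=\mathrm{Tr}\big(\rho\,\bigotimes_k A^{(k)}_{a_k|x_k}\big)$ for POVMs $A^{(k)}$ on complex Hilbert spaces and a density operator $\rho$ on their tensor product, and *classical* if $P(\vec a|\vec x)=\int\prod_k r_k(a_k|x_k,\lambda)\,d\mu(\lambda)$ for a probability measure $\mu$ and conditional distributions $r_k$. A (normalized) $q\to1$ connector, $q\ge1$, is a real tensor ${\sf C}_{b|y}^{\vec a|\vec x}$ such that the operators ${\sf C}_{b|y}[A]=\sum_{\vec a,\vec x}{\sf C}_{b|y}^{\vec a|\vec x}\bigotimes_kA^{(k)}_{a_k|x_k}$ form POVMs (one for each $y$) for all systems $A$ of POVMs. Put ${\sf C}_y=\sum_b b\,{\sf C}_{b|y}$ and $\langle {\sf C}_y\rangle_P=\sum_{b,\vec a,\vec x}b\,{\sf C}^{\vec a|\vec x}_{b|y}P(\vec a|\vec x)$. The connector is *XOR* if ${\sf C}_y[A]=\sum_{\vec x}c_{y,\vec x}\bigotimes_kK^{(k)}_{x_k}$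 for all $A$, with real coefficients $c_{y,\vec x}$ and $K^{(k)}_x=A^{(k)}_{+1|x}-A^{(k)}_{-1|x}$. An *XOR complex* $\mathcal C=({\sf C},\bar A,V)$ consists of an XOR connector ${\sf C}$, POVM systems $\bar A^{(k)}$ on Hilbert spaces $H_k$, and a coisometry $V:\bigotimes_kH_k\to H$ onto a Hilbert space $H\neq0$ such that the operators $\bar M_{b|y}=V{\sf C}_{b|y}[\bar A]V^\dagger$ are projectors with $\sum_b\bar M_{b|y}=\mathbb I$. The contraction of the output leg of $\mathcal C'$ with the $k$-th input leg of $\mathcal C$ is *congruent* if $\bar M(\mathcal C')=\bar A^{(k)}(\mathcal C)$ (up to a unitary identification of the two Hilbert spaces). For an XOR connector, $\gamma({\sf C})$ is the largest number with $-1\le\gamma({\sf C})\langle{\sf C}_y\rangle_P\le1$ for all $y$ and all classical $P$. **Proposition.** Let ${\sf C}$ be the tensor obtained by contracting, along a rooted tree, the connectors of XOR complexes $\mathcal C^1,\dots,\mathcal C^{n_c}$, all contractions being congruent; let $N$ be the number of uncontracted input legs and let $y$ be a setting of the root's output leg. Then 1. $-1\le\langle{\sf C}_y\rangle_P\le1$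 for all quantum behaviours $P$, and both bounds are attained by quantum behaviours; 2. every $\gamma({\sf C}(\mathcal C^k))$ exists (the maximum defining it is attained), and, with $\Gamma=\prod_{k=1}^{n_c}\gamma({\sf C}(\mathcal C^k))$, one has $-\frac1\Gamma\le\langle{\sf C}_y\rangle_P\le\frac1\Gamma$ for all classical behaviours $P$. **Corollary.** If $\gamma({\sf C}(\mathcal C^k))\ge\gamma_0>1$ for all $k$, then $\sup_{P\text{ classical}}\langle{\sf C}_y\rangle_P\le\gamma_0^{-n_c}$, and the quotient of the maximal quantum and the maximal classical value of ${\sf C}_y$ is at least $\gamma_0^{n_c}$. If moreover every $\mathcal C^k$ has at most $\bar q\ge2$ input legs, then $n_c\ge\big\lceil\frac{N-1}{\bar q-1}\big\rceil$, so this quotient is at least $\gamma_0^{(N-1)/(\bar q-1)}$, i.e. it grows at least exponentially with $N$. -/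

import Mathlib

/-! ### Hilbert space tensor products of finitely many factors -/

section HilbertTensor

open scoped ComplexOrder InnerProductSpace ComplexConjugate

universe u

theorem posSemidef_gram_of_any {n E : Type*} [NormedAddCommGroup E]
    [InnerProductSpace ℂ E] (v : n → E) : (Matrix.gram ℂ v).PosSemidef := by
  refine ⟨Matrix.isHermitian_gram ℂ v, fun c => ?_⟩
  have h : (c.sum fun i xi => c.sum fun j xj => star xi * Matrix.gram ℂ v i j * xj)
      = ⟪c.sum fun i r => r • v i, c.sum fun i r => r • v i⟫_ℂ := by
    simp only [Finsupp.sum, Matrix.gram_apply]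
    rw [sum_inner]
    refine Finset.sum_congr rfl fun i _ => ?_
    rw [inner_sum]
    refine Finset.sum_congr rfl fun j _ => ?_
    rw [inner_smul_left, inner_smul_right]
    simp only [RCLike.star_def]
    ring
  rw [h, inner_self_eq_norm_sq_to_K]
  positivity

theorem posSemidef_prod {n κ : Type*} (s : Finset κ) (G : κ → Matrix n n ℂ)
    (hG : ∀ k, (G k).PosSemidef) : (Matrix.of fun x y => ∏ k ∈ s, G k x y).PosSemidef := by
  classical
  induction s using Finset.induction_on with
  | empty =>
    have e : (Matrix.of fun x y => ∏ k ∈ (∅ : Finset κ), G k x y)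
        = Matrix.gram ℂ (fun _ : n => (1 : ℂ)) := by ext x y; simp
    rw [e]
    exact posSemidef_gram_of_any _
  | insert a s ha ih =>
    have e : (Matrix.of fun x y => ∏ k ∈ insert a s, G k x y)
        = (G a).hadamard (Matrix.of fun x y => ∏ k ∈ s, G k x y) := by
      ext x y; simp [Finset.prod_insert ha]
    rw [e]
    exact (hG a).hadamard ih

theorem posSemidef_prod_sub_prod {n κ : Type*} (s : Finset κ) (F G : κ → Matrix n n ℂ)
    (hF : ∀ k, (F k).PosSemidef) (hG : ∀ k, (G k).PosSemidef) (h : ∀ k, (F k - G k).PosSemidef) :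
    (Matrix.of fun x y => ∏ k ∈ s, F k x y - ∏ k ∈ s, G k x y).PosSemidef := by
  classical
  induction s using Finset.induction_on with
  | empty =>
    have e : (Matrix.of fun x y => ∏ k ∈ (∅ : Finset κ), F k x y - ∏ k ∈ (∅ : Finset κ), G k x y)
        = (0 : Matrix n n ℂ) := by ext x y; simp
    rw [e]
    exact Matrix.PosSemidef.zero
  | insert a s ha ih =>
    have e : (Matrix.of fun x y => ∏ k ∈ insert a s, F k x y - ∏ k ∈ insert a s, G k x y)
        = (F a - G a).hadamard (Matrix.of fun x y => ∏ k ∈ s, F k x y)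
          + (G a).hadamard (Matrix.of fun x y => ∏ k ∈ s, F k x y - ∏ k ∈ s, G k x y) := by
      ext x y; simp [Finset.prod_insert ha]; ring
    rw [e]
    exact ((h a).hadamard (posSemidef_prod s F hF)).add ((hG a).hadamard ih)

variable {ι : Type} [Fintype ι]

/-- The kernel `(x, y) ↦ ∏ₖ ⟪xₖ, yₖ⟫` on `∏ₖ Hₖ`. -/
noncomputable def tensorKernel (H : ι → Type u) [∀ k, NormedAddCommGroup (H k)]
    [∀ k, InnerProductSpace ℂ (H k)] : Matrix (∀ k, H k) (∀ k, H k) ℂ :=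
  Matrix.of fun x y => ∏ k, ⟪x k, y k⟫_ℂ

theorem posSemidef_tensorKernel (H : ι → Type u) [∀ k, NormedAddCommGroup (H k)]
    [∀ k, InnerProductSpace ℂ (H k)] : (tensorKernel H).PosSemidef :=
  posSemidef_prod Finset.univ (fun k => Matrix.gram ℂ fun x : ∀ k, H k => x k)
    fun _ => posSemidef_gram_of_any _

/-- The free vector space on the tuples `x ∈ ∏ₖ Hₖ`, with the semi-inner product determined by
`⟪x, y⟫ = ∏ₖ ⟪xₖ, yₖ⟫`. Its quotient by the null vectors is the algebraic tensor product. -/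
abbrev PreTensor (H : ι → Type u) : Type u := (∀ k, H k) →₀ ℂ

namespace PreTensor

variable (H : ι → Type u) [∀ k, NormedAddCommGroup (H k)] [∀ k, InnerProductSpace ℂ (H k)]

noncomputable instance core : PreInnerProductSpace.Core ℂ (PreTensor H) where
  inner f g := f.sum fun x r => g.sum fun y s => star r * tensorKernel H x y * s
  conj_inner_symm f g := by
    rw [Finsupp.sum_comm]
    simp only [map_finsuppSum]
    refine Finsupp.sum_congr fun x _ => Finsupp.sum_congr fun y _ => ?_
    rw [← (posSemidef_tensorKernel H).isHermitian.apply]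
    simp [mul_comm, mul_left_comm]
  re_inner_nonneg f := (Complex.le_def.1 ((posSemidef_tensorKernel H).2 f)).1
  add_left f g h := by
    rw [Finsupp.sum_add_index'] <;> simp [← Finsupp.sum_add, add_mul]
  smul_left f g r := by
    rw [Finsupp.sum_smul_index] <;> simp [Finsupp.mul_sum, ← mul_assoc]

noncomputable instance instSeminormedAddCommGroup : SeminormedAddCommGroup (PreTensor H) :=
  InnerProductSpace.Core.toSeminormedAddCommGroup (𝕜 := ℂ)

noncomputable instance instInnerProductSpace : InnerProductSpace ℂ (PreTensor H) := .ofCore _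

theorem inner_def (f g : PreTensor H) :
    ⟪f, g⟫_ℂ = f.sum fun x r => g.sum fun y s => star r * tensorKernel H x y * s := rfl

end PreTensor

/-- The Hilbert space tensor product `⨂ₖ Hₖ`: the completion of the above. By `tmul_update_add`,
`tmul_update_smul`, `inner_tmul` and `dense_span_tmul` below it is generated by a multilinear map
`tmul` with `⟪⨂ₖ xₖ, ⨂ₖ yₖ⟫ = ∏ₖ ⟪xₖ, yₖ⟫`, which determines it up to a unique unitary. -/
abbrev HilbertTensor (H : ι → Type u) [∀ k, NormedAddCommGroup (H k)]
    [∀ k, InnerProductSpace ℂ (H k)] : Type u :=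
  UniformSpace.Completion (PreTensor H)

namespace HilbertTensor

variable {H G : ι → Type u} [∀ k, NormedAddCommGroup (H k)] [∀ k, InnerProductSpace ℂ (H k)]
  [∀ k, NormedAddCommGroup (G k)] [∀ k, InnerProductSpace ℂ (G k)]

/-- The pure tensor `⨂ₖ xₖ`. -/
noncomputable def tmul (x : ∀ k, H k) : HilbertTensor H :=
  ((Finsupp.single x 1 : PreTensor H) : UniformSpace.Completion (PreTensor H))

theorem inner_tmul (x y : ∀ k, H k) : ⟪tmul x, tmul y⟫_ℂ = ∏ k, ⟪x k, y k⟫_ℂ := by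
  rw [tmul, tmul, UniformSpace.Completion.inner_coe, PreTensor.inner_def]
  simp [tensorKernel]

theorem coe_eq_sum (f : PreTensor H) :
    (f : HilbertTensor H) = f.sum fun x r => r • tmul x := by
  have h2 : UniformSpace.Completion.toComplₗᵢ (𝕜 := ℂ) (E := PreTensor H) f
      = UniformSpace.Completion.toComplₗᵢ (𝕜 := ℂ) (E := PreTensor H)
        (f.sum fun x r => r • Finsupp.single x (1 : ℂ)) := by
    congr 1
    conv_lhs => rw [← Finsupp.sum_single f]
    exact Finsupp.sum_congr fun x _ => (Finsupp.smul_single_one x _).symm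
  rw [map_finsuppSum] at h2
  simp only [map_smul] at h2
  exact h2

theorem dense_span_tmul :
    Dense (Submodule.span ℂ (Set.range (tmul (H := H))) : Set (HilbertTensor H)) := by
  refine UniformSpace.Completion.denseRange_coe.mono ?_
  rintro _ ⟨f, rfl⟩
  rw [coe_eq_sum]
  exact Submodule.sum_mem _ fun x _ => Submodule.smul_mem _ _ (Submodule.subset_span ⟨x, rfl⟩)

theorem ext_inner_tmul {u v : HilbertTensor H} (h : ∀ x, ⟪tmul x, u⟫_ℂ = ⟪tmul x, v⟫_ℂ) :
    u = v := by
  refine UniformSpace.Completion.denseRange_coe.eq_of_inner_right ℂ fun f => ?_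
  rw [coe_eq_sum, Finsupp.sum, sum_inner, sum_inner]
  simp [inner_smul_left, h]

theorem tmul_update_add [DecidableEq ι] (x : ∀ k, H k) (i : ι) (a b : H i) :
    tmul (Function.update x i (a + b))
      = tmul (Function.update x i a) + tmul (Function.update x i b) := by
  refine ext_inner_tmul fun z => ?_
  rw [inner_add_right, inner_tmul, inner_tmul, inner_tmul]
  simp only [← Finset.prod_erase_mul _ _ (Finset.mem_univ i), Function.update_self,
    inner_add_right, mul_add]
  congr 2 <;> exact Finset.prod_congr rfl fun k hk => by
    simp only [Function.update_of_ne (Finset.ne_of_mem_erase hk)]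

theorem tmul_update_smul [DecidableEq ι] (x : ∀ k, H k) (i : ι) (r : ℂ) (a : H i) :
    tmul (Function.update x i (r • a)) = r • tmul (Function.update x i a) := by
  refine ext_inner_tmul fun z => ?_
  rw [inner_smul_right, inner_tmul, inner_tmul]
  simp only [← Finset.prod_erase_mul _ _ (Finset.mem_univ i), Function.update_self,
    inner_smul_right]
  rw [mul_left_comm]
  congr 2
  exact Finset.prod_congr rfl fun k hk => by
    simp only [Function.update_of_ne (Finset.ne_of_mem_erase hk)]

theorem inner_mapDomain_self (f : ∀ k, H k →L[ℂ] G k) (z : PreTensor H) :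
    ⟪(z.mapDomain fun x k => f k (x k) : PreTensor G), z.mapDomain fun x k => f k (x k)⟫_ℂ
      = z.sum fun x r => z.sum fun y s => star r * (∏ k, ⟪f k (x k), f k (y k)⟫_ℂ) * s := by
  rw [PreTensor.inner_def, Finsupp.sum_mapDomain_index]
  · refine Finsupp.sum_congr fun x _ => ?_
    rw [Finsupp.sum_mapDomain_index]
    · rfl
    · simp
    · intros; ring
  · simp
  · intros; simp [add_mul, ← Finsupp.sum_add]

theorem norm_mapDomain_le (f : ∀ k, H k →L[ℂ] G k) (z : PreTensor H) :
    ‖(z.mapDomain fun x k => f k (x k) : PreTensor G)‖ ≤ (∏ k, ‖f k‖) * ‖z‖ := by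
  refine (sq_le_sq₀ (norm_nonneg _) (by positivity)).1 ?_
  rw [mul_pow, ← inner_self_eq_norm_sq (𝕜 := ℂ), ← inner_self_eq_norm_sq (𝕜 := ℂ),
    inner_mapDomain_self, PreTensor.inner_def]
  have key := (posSemidef_prod_sub_prod (Finset.univ : Finset ι)
    (fun k => ‖f k‖ ^ 2 • Matrix.gram ℂ fun x : ∀ k, H k => x k)
    (fun k => Matrix.gram ℂ fun x : ∀ k, H k => f k (x k))
    (fun k => (posSemidef_gram_of_any _).smul (sq_nonneg _))
    (fun k => posSemidef_gram_of_any _)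
    (fun k => Matrix.posSemidef_opNorm_smul_gram_sub_gram _ (f k))).2 z
  have h1 := (Complex.le_def.1 key).1
  simp only [Finsupp.sum, Matrix.of_apply, Matrix.smul_apply, Matrix.gram_apply,
    Complex.real_smul, Finset.prod_mul_distrib, mul_sub, sub_mul, Finset.sum_sub_distrib,
    Complex.sub_re, Complex.zero_re, sub_nonneg] at h1
  refine h1.trans (le_of_eq ?_)
  have e : ∀ w : ℂ, (∏ k, ‖f k‖) ^ 2 * RCLike.re w
      = ((∏ k, (((‖f k‖ ^ 2 : ℝ)) : ℂ)) * w).re := by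
    intro w
    rw [← Complex.ofReal_prod, Complex.re_ofReal_mul, Finset.prod_pow]
    rfl
  rw [e]
  congr 1
  simp only [Finsupp.sum, Finset.mul_sum, tensorKernel, Matrix.of_apply]
  refine Finset.sum_congr rfl fun x _ => Finset.sum_congr rfl fun y _ => ?_
  ring

/-- The bounded operator `⨂ₖ fₖ`, see `map_tmul`. -/
noncomputable def map (f : ∀ k, H k →L[ℂ] G k) : HilbertTensor H →L[ℂ] HilbertTensor G :=
  ((Finsupp.lmapDomain ℂ ℂ fun (x : ∀ k, H k) k => f k (x k) :
    PreTensor H →ₗ[ℂ] PreTensor G).mkContinuous (∏ k, ‖f k‖) (norm_mapDomain_le f)).completion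

theorem map_tmul (f : ∀ k, H k →L[ℂ] G k) (x : ∀ k, H k) :
    map f (tmul x) = tmul fun k => f k (x k) := by
  rw [map, tmul, ContinuousLinearMap.completion_apply_coe]
  exact congrArg _ Finsupp.mapDomain_single

end HilbertTensor

end HilbertTensor

/-! ### Behaviours, connectors and connector complexes with outcomes `±1` -/

section Connectors

open MeasureTheory

open scoped InnerProductSpace

universe u

/-- The values `a|x` of a leg with `m` settings: an outcome `a = ±1` and a setting `x`. -/
abbrev Leg (m : ℕ) : Type := ℤˣ × Fin m

/-- A system of `m` two-outcome POVMs `A_{a|x}` on `E`. -/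
structure IsMeasurement {E : Type u} [NormedAddCommGroup E] [InnerProductSpace ℂ E] {m : ℕ}
    (A : Leg m → E →L[ℂ] E) : Prop where
  isPositive : ∀ e, (A e).IsPositive
  sum_eq_one : ∀ x, ∑ a, A (a, x) = 1

/-- A system of `m` two-outcome projective measurements on `E`. -/
structure IsProjectiveMeasurement {E : Type u} [NormedAddCommGroup E] [InnerProductSpace ℂ E]
    [CompleteSpace E] {m : ℕ} (A : Leg m → E →L[ℂ] E) : Prop where
  isStarProjection : ∀ e, IsStarProjection (A e)
  sum_eq_one : ∀ x, ∑ a, A (a, x) = 1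

/-- The dichotomic operator `K_x = A_{+1|x} - A_{-1|x}`. -/
def dichotomic {E : Type u} [NormedAddCommGroup E] [InnerProductSpace ℂ E] {m : ℕ}
    (A : Leg m → E →L[ℂ] E) (x : Fin m) : E →L[ℂ] E :=
  A (1, x) - A (-1, x)

variable {ι : Type} [Fintype ι]

/-- A tensor `P(a|x)` with one leg for each party `k : ι`, who has `m k` settings. -/
abbrev Behaviour (m : ι → ℕ) : Type := (∀ k, Leg (m k)) → ℝ

/-- `P(a|x) = Tr(ρ ⨂ₖ A⁽ᵏ⁾_{aₖ|xₖ})` for POVMs `A⁽ᵏ⁾` on Hilbert spaces `Hₖ` and a density operator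
`ρ = ∑ⱼ pⱼ |ψⱼ⟩⟨ψⱼ|` on `⨂ₖ Hₖ`. -/
def IsQuantum {m : ι → ℕ} (P : Behaviour m) : Prop :=
  ∃ (H : ι → Type u) (_ : ∀ k, NormedAddCommGroup (H k)) (_ : ∀ k, InnerProductSpace ℂ (H k))
    (_ : ∀ k, CompleteSpace (H k)) (A : ∀ k, Leg (m k) → H k →L[ℂ] H k)
    (p : ℕ → ℝ) (ψ : ℕ → HilbertTensor H),
    (∀ k, IsMeasurement (A k)) ∧ (∀ j, 0 ≤ p j) ∧ HasSum p 1 ∧ (∀ j, ‖ψ j‖ = 1) ∧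
    ∀ z, HasSum (fun j => (p j : ℂ) * ⟪ψ j, HilbertTensor.map (fun k => A k (z k)) (ψ j)⟫_ℂ)
      (P z : ℂ)

/-- A local hidden variable model: `P(a|x) = ∫ ∏ₖ rₖ(aₖ|xₖ, l) dμ(l)` for a probability measure `μ` and
response functions `rₖ`. -/
def IsClassical {m : ι → ℕ} (P : Behaviour m) : Prop :=
  ∃ (Λ : Type) (_ : MeasurableSpace Λ) (μ : Measure Λ) (_ : IsProbabilityMeasure μ)
    (r : ∀ k, Leg (m k) → Λ → ℝ),
    (∀ k e, Measurable (r k e)) ∧ (∀ k e l, 0 ≤ r k e l) ∧ (∀ k x l, ∑ a, r k (a, x) l = 1) ∧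
    ∀ z, P z = ∫ l, ∏ k, r k (z k) l ∂μ

/-- A tensor `C_{b|y}^{a|x}` with one outgoing leg (`n` settings) and incoming legs `k : ι`
(`m k` settings). -/
abbrev ConnTensor (m : ι → ℕ) (n : ℕ) : Type := Leg n → (∀ k, Leg (m k)) → ℝ

namespace ConnTensor

variable [DecidableEq ι] {m : ι → ℕ} {n : ℕ}

/-- The operators `C_{b|y}[A] = ∑ C_{b|y}^{a|x} ⨂ₖ A⁽ᵏ⁾_{aₖ|xₖ}`. -/
noncomputable def op (C : ConnTensor m n) {H : ι → Type u} [∀ k, NormedAddCommGroup (H k)]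
    [∀ k, InnerProductSpace ℂ (H k)] (A : ∀ k, Leg (m k) → H k →L[ℂ] H k) (e : Leg n) :
    HilbertTensor H →L[ℂ] HilbertTensor H :=
  ∑ z, (C e z : ℂ) • HilbertTensor.map fun k => A k (z k)

/-- Normalized connectors: `C[A]` is a system of POVMs whenever all `A⁽ᵏ⁾` are. -/
def IsConnector (C : ConnTensor m n) : Prop :=
  ∀ (H : ι → Type u) [∀ k, NormedAddCommGroup (H k)] [∀ k, InnerProductSpace ℂ (H k)]
    [∀ k, CompleteSpace (H k)] (A : ∀ k, Leg (m k) → H k →L[ℂ] H k),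
    (∀ k, IsMeasurement (A k)) → IsMeasurement (C.op A)

/-- Each `C_y = C_{+1|y} - C_{-1|y}` is a full-correlation functional `∑ₓ c_{y,x} ⨂ₖ K⁽ᵏ⁾_{xₖ}`. -/
def IsXOR (C : ConnTensor m n) : Prop :=
  ∃ c : Fin n → (∀ k, Fin (m k)) → ℝ,
    ∀ (H : ι → Type u) [∀ k, NormedAddCommGroup (H k)] [∀ k, InnerProductSpace ℂ (H k)]
      [∀ k, CompleteSpace (H k)] (A : ∀ k, Leg (m k) → H k →L[ℂ] H k),
      (∀ k, IsMeasurement (A k)) → ∀ y,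
        dichotomic (C.op A) y
          = ∑ x, (c y x : ℂ) • HilbertTensor.map fun k => dichotomic (A k) (x k)

/-- The value `⟨C_y⟩_P` of the functional `C_y = ∑_b b C_{b|y}` on `P`. -/
def value (C : ConnTensor m n) (y : Fin n) (P : Behaviour m) : ℝ :=
  ∑ b : ℤˣ, ((b : ℤ) : ℝ) * ∑ z, C (b, y) z * P z

/-- The numbers `g` with `-1 ≤ g ⟨C_y⟩_P ≤ 1` for all `y` and all classical behaviours `P`. -/
def classicalFactors (C : ConnTensor m n) : Set ℝ :=
  {g | ∀ y P, IsClassical P → -1 ≤ g * C.value y P ∧ g * C.value y P ≤ 1}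

/-- The quantum-to-classical ratio `γ(C)`, the largest element of `classicalFactors`. -/
noncomputable def gamma (C : ConnTensor m n) : ℝ := sSup C.classicalFactors

/-- The maximal value of `⟨C_y⟩_P` over the quantum behaviours. -/
noncomputable def quantumMax (C : ConnTensor m n) (y : Fin n) : ℝ :=
  sSup {v | ∃ P, IsQuantum.{u} P ∧ C.value y P = v}

/-- The maximal value of `⟨C_y⟩_P` over the classical behaviours. -/
noncomputable def classicalMax (C : ConnTensor m n) (y : Fin n) : ℝ :=
  sSup {v | ∃ P, IsClassical P ∧ C.value y P = v}

end ConnTensor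

/-- A connector complex `(C, Ā, V)`: a normalized `q → 1` connector `C`, measurement systems `Ā⁽ᵏ⁾` on
`Hₖ` and a coisometry `V : ⨂ₖ Hₖ → Hout` such that the `V C_{b|y}[Ā] V†` form projective measurements.
The output system is nonzero. -/
structure ConnectorComplex where
  q : ℕ
  q_pos : 0 < q
  m : Fin q → ℕ
  n : ℕ
  C : ConnTensor m n
  H : Fin q → Type u
  [normedH : ∀ k, NormedAddCommGroup (H k)]
  [innerH : ∀ k, InnerProductSpace ℂ (H k)]
  [completeH : ∀ k, CompleteSpace (H k)]
  Hout : Type u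
  [normedOut : NormedAddCommGroup Hout]
  [innerOut : InnerProductSpace ℂ Hout]
  [completeOut : CompleteSpace Hout]
  [nontrivialOut : Nontrivial Hout]
  A : ∀ k, Leg (m k) → H k →L[ℂ] H k
  V : HilbertTensor H →L[ℂ] Hout
  isConnector : ConnTensor.IsConnector.{u} C
  isMeasurement : ∀ k, IsMeasurement (A k)
  coisometry : V ∘L ContinuousLinearMap.adjoint V = ContinuousLinearMap.id ℂ Hout
  isProjective : IsProjectiveMeasurement fun e =>
    V ∘L C.op A e ∘L ContinuousLinearMap.adjoint V

attribute [instance] ConnectorComplex.normedH ConnectorComplex.innerH ConnectorComplex.completeH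
  ConnectorComplex.normedOut ConnectorComplex.innerOut ConnectorComplex.completeOut
  ConnectorComplex.nontrivialOut

/-- The renormalized measurements `M̄_{b|y} = V C_{b|y}[Ā] V†`. -/
noncomputable def ConnectorComplex.M (D : ConnectorComplex.{u}) (e : Leg D.n) :
    D.Hout →L[ℂ] D.Hout :=
  D.V ∘L D.C.op D.A e ∘L ContinuousLinearMap.adjoint D.V

/-- A connector complex whose connector is an XOR connector. -/
structure XORComplex extends ConnectorComplex.{u} where
  isXOR : ConnTensor.IsXOR.{u} C

/-- A tree-like network of XOR complexes with one root, whose outgoing leg has `n` settings. In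
`node D child` the output of the network `child k` is plugged into the `k`-th incoming leg of `D`;
`child k = wire _` means that this leg is left open. -/
inductive Network : ℕ → Type (u + 1)
  | wire (n : ℕ) : Network n
  | node (D : XORComplex.{u}) (child : ∀ k : Fin D.q, Network (D.m k)) : Network D.n

namespace Network

/-- The open incoming legs of the network, i.e. the parties of the contracted functional. -/
def Leaf : {n : ℕ} → Network.{u} n → Type
  | _, wire _ => Unit
  | _, node D child => Σ k : Fin D.q, (child k).Leaf

/-- The complexes of the network (the root, or a complex in one of the subnetworks). -/
def Node : {n : ℕ} → Network.{u} n → Type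
  | _, wire _ => Empty
  | _, node D child => Option (Σ k : Fin D.q, (child k).Node)

instance instFintypeLeaf : {n : ℕ} → (T : Network.{u} n) → Fintype T.Leaf
  | _, wire _ => inferInstanceAs (Fintype Unit)
  | _, node D child =>
    letI := fun k => instFintypeLeaf (child k)
    inferInstanceAs (Fintype (Σ k : Fin D.q, (child k).Leaf))

instance instDecidableEqLeaf : {n : ℕ} → (T : Network.{u} n) → DecidableEq T.Leaf
  | _, wire _ => inferInstanceAs (DecidableEq Unit)
  | _, node D child =>
    letI := fun k => instDecidableEqLeaf (child k)
    inferInstanceAs (DecidableEq (Σ k : Fin D.q, (child k).Leaf))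

instance instFintypeNode : {n : ℕ} → (T : Network.{u} n) → Fintype T.Node
  | _, wire _ => inferInstanceAs (Fintype Empty)
  | _, node D child =>
    letI := fun k => instFintypeNode (child k)
    inferInstanceAs (Fintype (Option (Σ k : Fin D.q, (child k).Node)))

/-- The complex at a node. -/
def complexAt : {n : ℕ} → (T : Network.{u} n) → T.Node → XORComplex.{u}
  | _, wire _ => fun v => v.elim
  | _, node D child => fun v => v.elim D fun w => (child w.1).complexAt w.2

/-- The number of settings of a party. -/
def settings : {n : ℕ} → (T : Network.{u} n) → T.Leaf → ℕ
  | _, wire n => fun _ => n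
  | _, node _ child => fun l => (child l.1).settings l.2

/-- The contraction of the tensors of the network; an open leg carries the identity. -/
def tensor : {n : ℕ} → (T : Network.{u} n) → ConnTensor T.settings n
  | _, wire n => fun e z => (1 : Matrix (Leg n) (Leg n) ℝ) e (z ())
  | _, node D child => fun e z =>
    ∑ w : ∀ k, Leg (D.m k), D.C e w * ∏ k, (child k).tensor (w k) fun l => z ⟨k, l⟩

/-- The output measurements `M̄` of the root complex coincide with `A`, up to a unitary
identification of the two Hilbert spaces. No condition if there is no root complex. -/
def OutputIs : {n : ℕ} → Network.{u} n → {E : Type u} → [NormedAddCommGroup E] →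
    [InnerProductSpace ℂ E] → (Leg n → E →L[ℂ] E) → Prop
  | _, wire _, _, _, _, _ => True
  | _, node D _, E, _, _, A => ∃ U : D.Hout ≃ₗᵢ[ℂ] E, ∀ e φ, A e (U φ) = U (D.M e φ)

/-- All contractions of the network are congruent: whenever the output of a complex `D'` is plugged
into the `k`-th incoming leg of `D`, then `M̄(D') = Ā⁽ᵏ⁾(D)`. -/
def IsCongruent : {n : ℕ} → Network.{u} n → Prop
  | _, wire _ => True
  | _, node D child => ∀ k, (child k).OutputIs (D.A k) ∧ (child k).IsCongruent

/-- `Γ`, the product of the ratios `γ` of all complexes of the network. -/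
noncomputable def bigGamma {n : ℕ} (T : Network.{u} n) : ℝ := ∏ v, (T.complexAt v).C.gamma

end Network

end Connectors

/-!
Call measurements `A` of the parties together with a coisometry `V` a dilation of `B` for the
connector `C` if `V C_{b|y}[A] V† = B_{b|y}`. Congruence says that a child of a complex dilates the
measurements which its parent applies to that leg, so the coisometries of the children, tensored and
followed by that of the parent, again form a dilation: a congruent network dilates the projective
measurements of its root. For these `K_y = M̄_{+1|y} - M̄_{-1|y}` satisfies `K_y² = 1`, hence has an
eigenvector with eigenvalue `±1`, and pulling it back along `V` gives a pure state on which
`⟨C_y⟩` is extremal. As `C` is an XOR connector, flipping the outcomes of one party changes the sign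
of `⟨C_y⟩`, so both signs occur. The bound `1` itself only expresses that `C[A]` are POVMs.

For parties who respond independently argue by induction from the leaves: if the mean outcomes of
each child are at most `1 / Γₖ` in absolute value, then multiplying them by `Γₖ` gives mean outcomes
of admissible responses, on which the root is at most `1 / γ`. Its correlation functional is
multilinear, so the factors `Γₖ` multiply.
-/

section TensorMaps

open scoped InnerProductSpace

universe u

namespace HilbertTensor

variable {ι : Type} [Fintype ι] {H G K : ι → Type u}
  [∀ k, NormedAddCommGroup (H k)] [∀ k, InnerProductSpace ℂ (H k)]
  [∀ k, NormedAddCommGroup (G k)] [∀ k, InnerProductSpace ℂ (G k)]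
  [∀ k, NormedAddCommGroup (K k)] [∀ k, InnerProductSpace ℂ (K k)]

theorem clm_ext {F : Type*} [NormedAddCommGroup F] [NormedSpace ℂ F]
    {S T : HilbertTensor H →L[ℂ] F} (h : ∀ x, S (tmul x) = T (tmul x)) : S = T :=
  ContinuousLinearMap.ext_on dense_span_tmul (Set.forall_mem_range.2 h)

theorem map_one : map (fun k => (1 : H k →L[ℂ] H k)) = 1 :=
  clm_ext fun x => by simp [map_tmul]

theorem map_comp (g : ∀ k, G k →L[ℂ] K k) (f : ∀ k, H k →L[ℂ] G k) :
    map (fun k => g k ∘L f k) = map g ∘L map f :=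
  clm_ext fun x => by simp [map_tmul]

theorem adjoint_map [∀ k, CompleteSpace (H k)] [∀ k, CompleteSpace (G k)]
    (f : ∀ k, H k →L[ℂ] G k) :
    ContinuousLinearMap.adjoint (map f) = map fun k => ContinuousLinearMap.adjoint (f k) :=
  clm_ext fun x => ext_inner_tmul fun y => by
    simp [ContinuousLinearMap.adjoint_inner_right, map_tmul, inner_tmul]

theorem map_smul_univ (a : ι → ℂ) (f : ∀ k, H k →L[ℂ] G k) :
    map (fun k => a k • f k) = (∏ k, a k) • map f :=
  clm_ext fun x => ext_inner_tmul fun y => by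
    simp [map_tmul, inner_tmul, inner_smul_right, Finset.prod_mul_distrib]

theorem map_sum_smul [DecidableEq ι] {κ : ι → Type*} [∀ k, Fintype (κ k)] (a : ∀ k, κ k → ℂ)
    (f : ∀ k, κ k → H k →L[ℂ] G k) :
    map (fun k => ∑ j, a k j • f k j)
      = ∑ z : ∀ k, κ k, (∏ k, a k (z k)) • map fun k => f k (z k) :=
  clm_ext fun x => ext_inner_tmul fun y => by
    simp only [map_tmul, inner_tmul, sum_apply, smul_apply, inner_sum, inner_smul_right,
      Finset.prod_univ_sum, Fintype.piFinset_univ, Finset.prod_mul_distrib]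

theorem norm_tmul (x : ∀ k, H k) : ‖tmul x‖ = ∏ k, ‖x k‖ := by
  rw [← sq_eq_sq₀ (norm_nonneg _) (by positivity), ← Finset.prod_pow]
  have h : (‖tmul x‖ : ℂ) ^ 2 = ∏ k, (‖x k‖ : ℂ) ^ 2 := by
    simpa [inner_self_eq_norm_sq_to_K] using inner_tmul x x
  exact_mod_cast h

instance [∀ k, Nontrivial (H k)] : Nontrivial (HilbertTensor H) := by
  choose x hx using fun k => exists_ne (0 : H k)
  exact nontrivial_of_ne (tmul x) 0 <| norm_ne_zero_iff.1 <| by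
    simpa [norm_tmul, Finset.prod_ne_zero_iff] using hx

variable (H) in
/-- The universal multilinear map `x ↦ ⨂ₖ xₖ`, bundled. -/
noncomputable def tmulMultilinear : ContinuousMultilinearMap ℂ H (HilbertTensor H) :=
  MultilinearMap.mkContinuous ⟨tmul, tmul_update_add, tmul_update_smul⟩ 1 fun x => by
    simp [norm_tmul]

theorem tmulMultilinear_apply (x : ∀ k, H k) : tmulMultilinear H x = tmul x := rfl

end HilbertTensor

end TensorMaps

section TensorEquivs

open scoped InnerProductSpace

universe u

namespace HilbertTensor

variable {ι : Type} [Fintype ι] {H : ι → Type u}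
  [∀ k, NormedAddCommGroup (H k)] [∀ k, InnerProductSpace ℂ (H k)]

theorem tmul_mem_span {s : ∀ k, Set (H k)} {x : ∀ k, H k}
    (hx : ∀ k, x k ∈ Submodule.span ℂ (s k)) :
    tmul x ∈ Submodule.span ℂ (tmul '' Set.univ.pi s) := by
  classical
  choose l hl using fun k => (Finsupp.mem_span_iff_linearCombination ℂ (s k) (x k)).1 (hx k)
  obtain rfl : (fun k => ∑ a ∈ (l k).support, l k a • (a : H k)) = x := funext hl
  rw [← tmulMultilinear_apply, ContinuousMultilinearMap.map_sum_finset]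
  refine Submodule.sum_mem _ fun a _ => ?_
  rw [ContinuousMultilinearMap.map_smul_univ]
  exact Submodule.smul_mem _ _ <| Submodule.subset_span ⟨_, fun k _ => (a k).2, rfl⟩

theorem dense_span_tmul_image_pi {s : ∀ k, Set (H k)}
    (hs : ∀ k, Dense (Submodule.span ℂ (s k) : Set (H k))) :
    Dense (Submodule.span ℂ (tmul '' Set.univ.pi s) : Set (HilbertTensor H)) := by
  have tmul_mem (x : ∀ k, H k) :
      tmul x ∈ (Submodule.span ℂ (tmul '' Set.univ.pi s)).topologicalClosure :=
    map_mem_closure (tmulMultilinear H).cont (dense_pi Set.univ (fun k _ => hs k) x)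
      fun _ hx => tmul_mem_span fun k => hx k trivial
  have span_le := Submodule.span_le.2 (Set.range_subset_iff.2 tmul_mem)
  exact dense_closure.1 (dense_span_tmul.mono span_le)

section Lift

variable {F : Type*} [NormedAddCommGroup F] [InnerProductSpace ℂ F] {v : (∀ k, H k) → F}

theorem norm_linearCombination (hv : ∀ x y, ⟪v x, v y⟫_ℂ = ∏ k, ⟪x k, y k⟫_ℂ)
    (f : PreTensor H) : ‖Finsupp.linearCombination ℂ v f‖ = ‖(f : HilbertTensor H)‖ := by
  have h : ⟪Finsupp.linearCombination ℂ v f, Finsupp.linearCombination ℂ v f⟫_ℂ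
      = ⟪(f : HilbertTensor H), f⟫_ℂ := by
    simp only [coe_eq_sum, Finsupp.linearCombination_apply, Finsupp.sum_inner, Finsupp.inner_sum,
      inner_smul_left, inner_smul_right, inner_tmul, hv]
  rw [norm_eq_sqrt_re_inner (𝕜 := ℂ), h, norm_eq_sqrt_re_inner (𝕜 := ℂ)]

/-- The unitary from the Hilbert space tensor product onto a Hilbert space generated by a family
`v` with the Gram matrix of the pure tensors. -/
noncomputable def liftEquiv [CompleteSpace F] (hv : ∀ x y, ⟪v x, v y⟫_ℂ = ∏ k, ⟪x k, y k⟫_ℂ)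
    (hd : Dense (Submodule.span ℂ (Set.range v) : Set F)) : HilbertTensor H ≃ₗᵢ[ℂ] F :=
  (LinearEquiv.refl ℂ (PreTensor H)).extendOfIsometry
    (UniformSpace.Completion.toComplₗᵢ (𝕜 := ℂ)).toLinearMap (Finsupp.linearCombination ℂ v)
    UniformSpace.Completion.denseRange_coe
    (by simpa only [DenseRange, ← LinearMap.coe_range, Finsupp.range_linearCombination] using hd)
    (norm_linearCombination hv)

theorem liftEquiv_tmul [CompleteSpace F] (hv : ∀ x y, ⟪v x, v y⟫_ℂ = ∏ k, ⟪x k, y k⟫_ℂ)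
    (hd : Dense (Submodule.span ℂ (Set.range v) : Set F)) (x : ∀ k, H k) :
    liftEquiv hv hd (tmul x) = v x :=
  (LinearEquiv.extendOfIsometry_eq _ _ _ _ _ (norm_linearCombination hv)
    (Finsupp.single x 1)).trans (by simp)

end Lift

/-- The tensor product of a single Hilbert space is that space. -/
noncomputable def unitEquiv (E : Unit → Type u) [∀ k, NormedAddCommGroup (E k)]
    [∀ k, InnerProductSpace ℂ (E k)] [∀ k, CompleteSpace (E k)] : HilbertTensor E ≃ₗᵢ[ℂ] E () :=
  liftEquiv (v := fun x => x ()) (fun x y => by simp) <| by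
    rw [(Function.surjective_eval ()).range_eq, Submodule.span_univ]
    exact dense_univ

theorem unitEquiv_tmul (E : Unit → Type u) [∀ k, NormedAddCommGroup (E k)]
    [∀ k, InnerProductSpace ℂ (E k)] [∀ k, CompleteSpace (E k)] (x : ∀ k, E k) :
    unitEquiv E (tmul x) = x () :=
  liftEquiv_tmul _ _ x

theorem conjStarAlgEquiv_unitEquiv_map (E : Unit → Type u) [∀ k, NormedAddCommGroup (E k)]
    [∀ k, InnerProductSpace ℂ (E k)] [∀ k, CompleteSpace (E k)] (f : ∀ k, E k →L[ℂ] E k) :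
    (unitEquiv E).conjStarAlgEquiv (map f) = f () := by
  have intertwine : (unitEquiv E : _ →L[ℂ] _) ∘L map f = f () ∘L (unitEquiv E : _ →L[ℂ] _) :=
    clm_ext fun x => by simp [map_tmul, unitEquiv_tmul]
  ext1 y
  simpa using congr($intertwine ((unitEquiv E).symm y))

section Sigma

variable {κ : ι → Type} [∀ k, Fintype (κ k)] (L : (Σ k, κ k) → Type u)
  [∀ l, NormedAddCommGroup (L l)] [∀ l, InnerProductSpace ℂ (L l)]

/-- Associativity of the Hilbert space tensor product. -/
noncomputable def sigmaEquiv :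
    HilbertTensor L ≃ₗᵢ[ℂ] HilbertTensor fun k => HilbertTensor fun l : κ k => L ⟨k, l⟩ :=
  liftEquiv (v := fun x => tmul fun k => tmul fun l => x ⟨k, l⟩)
    (fun x y => by simp only [inner_tmul, Fintype.prod_sigma]) <| by
    refine (dense_span_tmul_image_pi fun k => dense_span_tmul).mono (Submodule.span_mono ?_)
    rintro _ ⟨z, hz, rfl⟩
    choose x hx using fun k => hz k trivial
    exact ⟨fun l => x l.1 l.2, congrArg tmul (funext hx)⟩

theorem sigmaEquiv_tmul (x : ∀ l, L l) :
    sigmaEquiv L (tmul x) = tmul fun k => tmul fun l => x ⟨k, l⟩ :=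
  liftEquiv_tmul _ _ x

variable {L}

theorem conjStarAlgEquiv_sigmaEquiv_map (f : ∀ l, L l →L[ℂ] L l) :
    (sigmaEquiv L).conjStarAlgEquiv (map f) = map fun k => map fun l => f ⟨k, l⟩ := by
  have intertwine : (sigmaEquiv L : _ →L[ℂ] _) ∘L map f
      = (map fun k => map fun l => f ⟨k, l⟩) ∘L (sigmaEquiv L : _ →L[ℂ] _) :=
    clm_ext fun x => by simp [map_tmul, sigmaEquiv_tmul]
  ext1 y
  simpa using congr($intertwine ((sigmaEquiv L).symm y))

end Sigma

end HilbertTensor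

end TensorEquivs

section Measurements

open scoped InnerProductSpace InnerProduct

universe u

theorem sum_intUnits {M : Type*} [AddCommMonoid M] (f : ℤˣ → M) : ∑ a, f a = f 1 + f (-1) := by
  rw [show (Finset.univ : Finset ℤˣ) = {1, -1} from rfl, Finset.sum_pair (by decide)]

/-- `V` is a coisometry: its adjoint is an isometry, so `V T V†` is the compression of `T`. -/
def IsCoisometry {E F : Type*} [NormedAddCommGroup E] [InnerProductSpace ℂ E] [CompleteSpace E]
    [NormedAddCommGroup F] [InnerProductSpace ℂ F] [CompleteSpace F] (V : E →L[ℂ] F) : Prop :=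
  V ∘L V† = .id ℂ F

namespace IsCoisometry

variable {E F G : Type*} [NormedAddCommGroup E] [InnerProductSpace ℂ E] [CompleteSpace E]
  [NormedAddCommGroup F] [InnerProductSpace ℂ F] [CompleteSpace F]
  [NormedAddCommGroup G] [InnerProductSpace ℂ G] [CompleteSpace G]

theorem coe_linearIsometryEquiv (U : E ≃ₗᵢ[ℂ] F) : IsCoisometry (U : E →L[ℂ] F) := by
  ext x
  simp [LinearIsometryEquiv.adjoint_eq_symm]

theorem comp {W : F →L[ℂ] G} {V : E →L[ℂ] F} (hW : IsCoisometry W) (hV : IsCoisometry V) :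
    IsCoisometry (W ∘L V) := by
  rw [IsCoisometry, ContinuousLinearMap.adjoint_comp, ContinuousLinearMap.comp_assoc,
    ← ContinuousLinearMap.comp_assoc V, show V ∘L V† = _ from hV, ContinuousLinearMap.id_comp, hW]

theorem map {ι : Type} [Fintype ι] {H K : ι → Type u} [∀ k, NormedAddCommGroup (H k)]
    [∀ k, InnerProductSpace ℂ (H k)] [∀ k, CompleteSpace (H k)] [∀ k, NormedAddCommGroup (K k)]
    [∀ k, InnerProductSpace ℂ (K k)] [∀ k, CompleteSpace (K k)] {V : ∀ k, H k →L[ℂ] K k}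
    (hV : ∀ k, IsCoisometry (V k)) : IsCoisometry (HilbertTensor.map V) := by
  rw [IsCoisometry, HilbertTensor.adjoint_map, ← HilbertTensor.map_comp]
  exact (congrArg HilbertTensor.map (funext hV)).trans HilbertTensor.map_one

theorem norm_adjoint_apply {V : E →L[ℂ] F} (hV : IsCoisometry V) (x : F) : ‖(V†) x‖ = ‖x‖ :=
  (V†).norm_map_iff_adjoint_comp_self.2 (by rwa [ContinuousLinearMap.adjoint_adjoint]) x

end IsCoisometry

section

variable {E F : Type u} [NormedAddCommGroup E] [InnerProductSpace ℂ E] [NormedAddCommGroup F]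
  [InnerProductSpace ℂ F] {m : ℕ}

theorem IsMeasurement.compress [CompleteSpace E] [CompleteSpace F] {A : Leg m → E →L[ℂ] E}
    (hA : IsMeasurement A) {V : E →L[ℂ] F} (hV : IsCoisometry V) :
    IsMeasurement fun e => V ∘L A e ∘L V† where
  isPositive e := (hA.isPositive e).conj_adjoint V
  sum_eq_one x := by
    rw [← ContinuousLinearMap.comp_finsetSum, ← ContinuousLinearMap.finsetSum_comp,
      hA.sum_eq_one]
    exact hV

theorem IsMeasurement.of_conjStarAlgEquiv [CompleteSpace E] [CompleteSpace F]
    {A : Leg m → E →L[ℂ] E} (U : E ≃ₗᵢ[ℂ] F)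
    (hA : IsMeasurement fun e => U.conjStarAlgEquiv (A e)) : IsMeasurement A := by
  convert hA.compress (IsCoisometry.coe_linearIsometryEquiv U.symm) with e
  rw [LinearIsometryEquiv.adjoint_eq_symm]
  ext φ
  simp

/-- The measurements `A` with all outcomes multiplied by `s`. -/
def flipOutcome {β : Type*} (s : ℤˣ) (A : Leg m → β) (e : Leg m) : β := A (s * e.1, e.2)

theorem IsMeasurement.flipOutcome {A : Leg m → E →L[ℂ] E} (hA : IsMeasurement A) (s : ℤˣ) :
    IsMeasurement (flipOutcome s A) where
  isPositive _ := hA.isPositive _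
  sum_eq_one x :=
    (Fintype.sum_equiv (Equiv.mulLeft s) _ _ fun _ => rfl).trans (hA.sum_eq_one x)

theorem dichotomic_flipOutcome (s : ℤˣ) (A : Leg m → E →L[ℂ] E) (x : Fin m) :
    dichotomic (flipOutcome s A) x = (((s : ℤ) : ℝ) : ℂ) • dichotomic A x := by
  rcases Int.units_eq_one_or s with rfl | rfl <;> simp [dichotomic, flipOutcome]

theorem dichotomic_compress [CompleteSpace E] [CompleteSpace F] (A : Leg m → E →L[ℂ] E)
    (V : E →L[ℂ] F) (x : Fin m) :
    dichotomic (fun e => V ∘L A e ∘L V†) x = V ∘L dichotomic A x ∘L V† := by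
  simp only [dichotomic, ContinuousLinearMap.comp_sub, ContinuousLinearMap.sub_comp]

namespace IsProjectiveMeasurement

variable [CompleteSpace E] {A : Leg m → E →L[ℂ] E}

theorem isMeasurement (hA : IsProjectiveMeasurement A) : IsMeasurement A :=
  ⟨fun e => (ContinuousLinearMap.nonneg_iff_isPositive _).1 (hA.isStarProjection e).nonneg,
    hA.sum_eq_one⟩

theorem dichotomic_mul_self (hA : IsProjectiveMeasurement A) (x : Fin m) :
    dichotomic A x * dichotomic A x = 1 := by
  have idem := (hA.isStarProjection (1, x)).isIdempotentElem.eq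
  have compl : A (-1, x) = 1 - A (1, x) := by
    rw [← hA.sum_eq_one x, sum_intUnits, add_sub_cancel_left]
  simp only [dichotomic, compl, mul_sub, sub_mul, idem, mul_one, one_mul]
  abel

theorem exists_dichotomic_eigenvector [Nontrivial E] (hA : IsProjectiveMeasurement A) (x : Fin m) :
    ∃ φ, ‖φ‖ = 1 ∧ (dichotomic A x φ = φ ∨ dichotomic A x φ = -φ) := by
  suffices ∃ φ ≠ 0, dichotomic A x φ = φ ∨ dichotomic A x φ = -φ by
    obtain ⟨φ, hφ, h⟩ := this
    refine ⟨(‖φ‖⁻¹ : ℂ) • φ, by simp [norm_smul, hφ], ?_⟩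
    simpa only [map_smul, ← smul_neg] using h.imp (congrArg _) (congrArg _)
  obtain ⟨v, hv⟩ := exists_ne (0 : E)
  by_cases h : v + dichotomic A x v = 0
  · exact ⟨v, hv, .inr (eq_neg_of_add_eq_zero_right h)⟩
  · refine ⟨_, h, .inl ?_⟩
    have h2 := congr($(hA.dichotomic_mul_self x) v)
    rw [map_add, show dichotomic A x (dichotomic A x v) = v from h2, add_comm]

end IsProjectiveMeasurement

end

end Measurements

section RealTensors

open scoped InnerProduct

universe u

variable {ι : Type} [Fintype ι] [DecidableEq ι]

/-- A real tensor with one leg for each `k : ι`, whose index ranges over `σ k`. The tensors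
`C_{b|y}` of a connector and its correlation coefficients `c_y` are both of this form. -/
abbrev RealTensor (σ : ι → Type*) : Type _ := (∀ k, σ k) → ℝ

namespace RealTensor

variable {σ : ι → Type*} [∀ k, Fintype (σ k)]

/-- The multilinear form with coefficients `c`. -/
def eval (c : RealTensor σ) (r : ∀ k, σ k → ℝ) : ℝ :=
  ∑ z, c z * ∏ k, r k (z k)

theorem eval_smul (c : RealTensor σ) (a : ι → ℝ) (r : ∀ k, σ k → ℝ) :
    eval c (fun k j => a k * r k j) = (∏ k, a k) * eval c r := by
  simp only [eval, Finset.mul_sum, Finset.prod_mul_distrib, mul_left_comm]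

theorem eval_apply_single [∀ k, DecidableEq (σ k)] (c : RealTensor σ) (x : ∀ k, σ k) :
    eval c (fun k => Pi.single (x k) 1) = c x := by
  rw [eval, Fintype.sum_eq_single x fun z hz => ?_]
  · simp
  · obtain ⟨k, hk⟩ := Function.ne_iff.1 hz
    rw [Finset.prod_eq_zero (Finset.mem_univ k) (Pi.single_eq_of_ne hk 1), mul_zero]

theorem eval_single [∀ k, DecidableEq (σ k)] (x : ∀ k, σ k) (r : ∀ k, σ k → ℝ) :
    eval (Pi.single x 1) r = ∏ k, r k (x k) := by
  simp [eval, Pi.single_apply]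

section Operators

variable {H K : ι → Type u} [∀ k, NormedAddCommGroup (H k)] [∀ k, InnerProductSpace ℂ (H k)]
  [∀ k, NormedAddCommGroup (K k)] [∀ k, InnerProductSpace ℂ (K k)]

/-- The operator `∑_z c_z ⨂ₖ f⁽ᵏ⁾_{zₖ}`. -/
noncomputable def op (c : RealTensor σ) (f : ∀ k, σ k → H k →L[ℂ] H k) :
    HilbertTensor H →L[ℂ] HilbertTensor H :=
  ∑ z, (c z : ℂ) • HilbertTensor.map fun k => f k (z k)

theorem op_single [∀ k, DecidableEq (σ k)] (x : ∀ k, σ k) (f : ∀ k, σ k → H k →L[ℂ] H k) :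
    op (Pi.single x 1) f = HilbertTensor.map fun k => f k (x k) := by
  simp [op, Pi.single_apply, apply_ite Complex.ofReal, ite_smul]

theorem op_smul_one (c : RealTensor σ) (r : ∀ k, σ k → ℝ) :
    op c (fun k j => (r k j : ℂ) • (1 : H k →L[ℂ] H k)) = (eval c r : ℂ) • 1 := by
  simp only [op, eval, HilbertTensor.map_smul_univ, HilbertTensor.map_one, smul_smul,
    ← Finset.sum_smul, Complex.ofReal_sum, Complex.ofReal_mul, Complex.ofReal_prod]

theorem op_smul (c : RealTensor σ) (a : ι → ℝ) (f : ∀ k, σ k → H k →L[ℂ] H k) :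
    op c (fun k j => (a k : ℂ) • f k j) = ((∏ k, a k : ℝ) : ℂ) • op c f := by
  simp only [op, HilbertTensor.map_smul_univ, Finset.smul_sum, smul_comm (c _ : ℂ),
    Complex.ofReal_prod]

theorem op_compress [∀ k, CompleteSpace (H k)] [∀ k, CompleteSpace (K k)] (c : RealTensor σ)
    (f : ∀ k, σ k → H k →L[ℂ] H k) (V : ∀ k, H k →L[ℂ] K k) :
    op c (fun k j => V k ∘L f k j ∘L (V k)†)
      = HilbertTensor.map V ∘L op c f ∘L (HilbertTensor.map V)† := by
  simp only [op, HilbertTensor.map_comp, HilbertTensor.adjoint_map,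
    ContinuousLinearMap.comp_finsetSum, ContinuousLinearMap.finsetSum_comp,
    ContinuousLinearMap.comp_smul, ContinuousLinearMap.smul_comp]

end Operators

section Contraction

variable {κ : ι → Type} [∀ k, Fintype (κ k)] [∀ k, DecidableEq (κ k)]
  {τ : (Σ k, κ k) → Type*} [∀ l, Fintype (τ l)]

/-- The contraction of each leg of `c` with the first index of `b k`. -/
def comp (c : RealTensor σ) (b : ∀ k, σ k → RealTensor fun l : κ k => τ ⟨k, l⟩) :
    RealTensor τ :=
  fun z => ∑ w, c w * ∏ k, b k (w k) fun l => z ⟨k, l⟩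

variable (c : RealTensor σ) (b : ∀ k, σ k → RealTensor fun l : κ k => τ ⟨k, l⟩)

theorem eval_comp (r : ∀ l, τ l → ℝ) :
    eval (comp c b) r = eval c fun k j => eval (b k j) fun l => r ⟨k, l⟩ := by
  simp only [eval, comp, Finset.prod_univ_sum, Fintype.piFinset_univ, Finset.mul_sum,
    Finset.sum_mul]
  rw [Finset.sum_comm]
  refine Finset.sum_congr rfl fun w _ => ?_
  refine Fintype.sum_equiv (Equiv.piCurry fun k l => τ ⟨k, l⟩) _ _ fun z => ?_
  rw [Fintype.prod_sigma, Finset.prod_mul_distrib, mul_assoc]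
  rfl

theorem conjStarAlgEquiv_sigmaEquiv_op_comp {L : (Σ k, κ k) → Type u}
    [∀ l, NormedAddCommGroup (L l)] [∀ l, InnerProductSpace ℂ (L l)]
    (f : ∀ l, τ l → L l →L[ℂ] L l) :
    (HilbertTensor.sigmaEquiv L).conjStarAlgEquiv (op (comp c b) f)
      = op c fun k j => op (b k j) fun l => f ⟨k, l⟩ := by
  simp only [op, comp, map_sum, map_smul, HilbertTensor.conjStarAlgEquiv_sigmaEquiv_map,
    HilbertTensor.map_sum_smul, Complex.ofReal_sum, Complex.ofReal_mul, Complex.ofReal_prod,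
    Finset.sum_smul, Finset.smul_sum, smul_smul]
  rw [Finset.sum_comm]
  exact Finset.sum_congr rfl fun w _ =>
    Fintype.sum_equiv (Equiv.piCurry fun k l => τ ⟨k, l⟩) _ _ fun z => rfl

end Contraction

end RealTensor

end RealTensors

section Responses

open scoped InnerProductSpace

universe u

/-- A conditional distribution of the outcome given the setting: the response of a party in a
local hidden variable model for a fixed value of the hidden variable. -/
structure IsResponse {m : ℕ} (r : Leg m → ℝ) : Prop where
  nonneg : ∀ e, 0 ≤ r e
  sum_eq_one : ∀ x, ∑ a, r (a, x) = 1

/-- The mean outcome for each setting, the scalar counterpart of `dichotomic`. -/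
def meanOutcome {m : ℕ} (r : Leg m → ℝ) (x : Fin m) : ℝ := r (1, x) - r (-1, x)

variable {m : ℕ}

namespace IsResponse

variable {r : Leg m → ℝ}

theorem le_one (h : IsResponse r) (e : Leg m) : r e ≤ 1 :=
  h.sum_eq_one e.2 ▸
    Finset.single_le_sum (f := fun a => r (a, e.2)) (fun _ _ => h.nonneg _) (Finset.mem_univ e.1)

theorem abs_meanOutcome_le (h : IsResponse r) (x : Fin m) : |meanOutcome r x| ≤ 1 := by
  rw [meanOutcome, abs_le]
  constructor <;> linarith [h.nonneg (1, x), h.nonneg (-1, x), h.le_one (1, x), h.le_one (-1, x)]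

theorem isMeasurement_smul_one (h : IsResponse r) {E : Type u} [NormedAddCommGroup E]
    [InnerProductSpace ℂ E] : IsMeasurement fun e => (r e : ℂ) • (1 : E →L[ℂ] E) where
  isPositive e :=
    ContinuousLinearMap.isPositive_one.smul_of_nonneg (Complex.zero_le_real.2 (h.nonneg e))
  sum_eq_one x := by
    rw [← Finset.sum_smul, ← Complex.ofReal_sum, h.sum_eq_one, Complex.ofReal_one, one_smul]

end IsResponse

theorem exists_isResponse_meanOutcome_eq {K : Fin m → ℝ} (hK : ∀ x, |K x| ≤ 1) :
    ∃ r, IsResponse r ∧ meanOutcome r = K := by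
  refine ⟨fun e => (1 + ((e.1 : ℤ) : ℝ) * K e.2) / 2, ⟨?_, fun x => ?_⟩, funext fun x => ?_⟩
  · rintro ⟨a, x⟩
    have := abs_le.1 (hK x)
    rcases Int.units_eq_one_or a with rfl | rfl <;> simp <;> linarith
  · rw [sum_intUnits]
    push_cast
    ring
  · rw [meanOutcome]
    push_cast
    ring

section Expectation

variable {E : Type u} [NormedAddCommGroup E] [InnerProductSpace ℂ E] {A : Leg m → E →L[ℂ] E}

theorem IsMeasurement.isResponse_inner (hA : IsMeasurement A) {ψ : E} (hψ : ‖ψ‖ = 1) :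
    IsResponse fun e => (⟪ψ, A e ψ⟫_ℂ).re where
  nonneg e := (hA.isPositive e).re_inner_nonneg_right ψ
  sum_eq_one x := by
    rw [← Complex.re_sum, ← inner_sum, ← sum_apply, hA.sum_eq_one, one_apply_eq_self,
      inner_self_eq_norm_sq_to_K, hψ]
    simp

theorem meanOutcome_inner (A : Leg m → E →L[ℂ] E) (ψ : E) (x : Fin m) :
    meanOutcome (fun e => (⟪ψ, A e ψ⟫_ℂ).re) x = (⟪ψ, dichotomic A x ψ⟫_ℂ).re := by
  rw [meanOutcome, dichotomic, sub_apply, inner_sub_right, Complex.sub_re]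

theorem isResponse_of_isMeasurement_smul_one [Nontrivial E] {r : Leg m → ℝ}
    (h : IsMeasurement fun e => (r e : ℂ) • (1 : E →L[ℂ] E)) : IsResponse r := by
  obtain ⟨ψ, hψ⟩ := exists_norm_eq E zero_le_one
  simpa [inner_smul_right, inner_self_eq_norm_sq_to_K, hψ] using h.isResponse_inner hψ

theorem dichotomic_smul_one (r : Leg m → ℝ) (x : Fin m) :
    dichotomic (fun e => (r e : ℂ) • (1 : E →L[ℂ] E)) x = (meanOutcome r x : ℂ) • 1 := by
  rw [dichotomic, ← sub_smul, meanOutcome, Complex.ofReal_sub]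

end Expectation

end Responses

section Values

open MeasureTheory

variable {ι : Type} [Fintype ι] {m : ι → ℕ} {n : ℕ}

theorem isClassical_prod {r : ∀ k, Leg (m k) → ℝ} (h : ∀ k, IsResponse (r k)) :
    IsClassical fun z => ∏ k, r k (z k) :=
  ⟨Unit, ⊤, Measure.dirac (), inferInstance, fun k e _ => r k e, fun _ _ => measurable_const,
    fun k e _ => (h k).nonneg e, fun k x _ => (h k).sum_eq_one x, fun z => by simp⟩

variable [DecidableEq ι]

namespace ConnTensor

/-- The response of the output leg when the party `k` answers according to `r k`. -/
def eval (C : ConnTensor m n) (r : ∀ k, Leg (m k) → ℝ) (e : Leg n) : ℝ :=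
  RealTensor.eval (C e) r

theorem value_eq_meanOutcome (C : ConnTensor m n) (y : Fin n) (P : Behaviour m) :
    C.value y P = meanOutcome (fun e => ∑ z, C e z * P z) y := by
  rw [value, sum_intUnits, meanOutcome]
  push_cast
  ring

theorem value_prod (C : ConnTensor m n) (y : Fin n) (r : ∀ k, Leg (m k) → ℝ) :
    C.value y (fun z => ∏ k, r k (z k)) = meanOutcome (C.eval r) y :=
  C.value_eq_meanOutcome y _

theorem hasSum_value (C : ConnTensor m n) (y : Fin n) {α : Type*} {Q : α → Behaviour m}
    {P : Behaviour m} (h : ∀ z, HasSum (fun j => Q j z) (P z)) :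
    HasSum (fun j => C.value y (Q j)) (C.value y P) :=
  hasSum_sum fun _ _ => (hasSum_sum fun z _ => (h z).mul_left _).mul_left _

theorem value_integral (C : ConnTensor m n) (y : Fin n) {Λ : Type*} [MeasurableSpace Λ]
    {μ : Measure Λ} {Q : Λ → Behaviour m} (hQ : ∀ z, Integrable (fun l => Q l z) μ) :
    C.value y (fun z => ∫ l, Q l z ∂μ) = ∫ l, C.value y (Q l) ∂μ := by
  simp only [value]
  rw [integral_finsetSum _ fun b _ =>
    (integrable_finsetSum _ fun z _ => (hQ z).const_mul _).const_mul _]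
  refine Finset.sum_congr rfl fun b _ => ?_
  rw [integral_const_mul, integral_finsetSum _ fun z _ => (hQ z).const_mul _]
  simp only [integral_const_mul]

end ConnTensor

theorem IsClassical.abs_value_le {P : Behaviour m} (hP : IsClassical P) {C : ConnTensor m n}
    {y : Fin n} {B : ℝ}
    (hB : ∀ r : ∀ k, Leg (m k) → ℝ, (∀ k, IsResponse (r k)) → |meanOutcome (C.eval r) y| ≤ B) :
    |C.value y P| ≤ B := by
  obtain ⟨Λ, _, μ, _, r, hmeas, hnonneg, hsum, hP⟩ := hP
  have hr (l k) : IsResponse fun e => r k e l := ⟨(hnonneg k · l), (hsum k · l)⟩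
  have hint (z : ∀ k, Leg (m k)) : Integrable (fun l => ∏ k, r k (z k) l) μ := by
    refine .of_bound (C := 1)
      (Finset.measurable_prod _ fun k _ => hmeas k (z k)).aestronglyMeasurable (.of_forall ?_)
    intro l
    rw [Real.norm_of_nonneg (Finset.prod_nonneg fun k _ => hnonneg k _ l)]
    exact Finset.prod_le_one (fun k _ => hnonneg k _ l) fun k _ => (hr l k).le_one _
  obtain rfl : P = fun z => ∫ l, ∏ k, r k (z k) l ∂μ := funext hP
  have bound (l) : |C.value y fun z => ∏ k, r k (z k) l| ≤ B :=
    (C.value_prod y fun k e => r k e l).symm ▸ hB _ (hr l)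
  rw [C.value_integral y hint]
  simpa using norm_integral_le_of_norm_le_const (μ := μ) (.of_forall fun l =>
    (Real.norm_eq_abs _).trans_le (bound l))

end Values

section Connectors

open scoped InnerProductSpace InnerProduct

universe u

/-- The one-dimensional Hilbert space `ℂ`, in any universe. -/
abbrev ScalarSpace : Type u := EuclideanSpace ℂ PUnit.{u + 1}

variable {ι : Type} [Fintype ι] [DecidableEq ι] {m : ι → ℕ} {n : ℕ}

namespace ConnTensor

variable {C : ConnTensor m n} {H : ι → Type u} [∀ k, NormedAddCommGroup (H k)]
  [∀ k, InnerProductSpace ℂ (H k)]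

theorem op_smul_one (C : ConnTensor m n) (r : ∀ k, Leg (m k) → ℝ) :
    C.op (fun k e => (r k e : ℂ) • (1 : H k →L[ℂ] H k)) = fun e => (C.eval r e : ℂ) • 1 :=
  funext fun e => RealTensor.op_smul_one (C e) r

theorem IsConnector.isResponse_eval (hC : IsConnector.{u} C) {r : ∀ k, Leg (m k) → ℝ}
    (h : ∀ k, IsResponse (r k)) : IsResponse (C.eval r) :=
  isResponse_of_isMeasurement_smul_one <| C.op_smul_one (H := fun _ => ScalarSpace.{u}) r ▸
    hC _ _ fun k => (h k).isMeasurement_smul_one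

theorem IsConnector.settings_pos (hC : IsConnector.{u} C) (y : Fin n) (k : ι) : 0 < m k := by
  by_contra h
  have : IsEmpty (∀ k, Leg (m k)) := ⟨fun z => h (z k).2.pos⟩
  have hr : IsResponse (C.eval fun _ _ => 1 / 2) :=
    hC.isResponse_eval fun j => ⟨fun _ => by norm_num, fun _ => by rw [sum_intUnits]; norm_num⟩
  simpa [eval, RealTensor.eval] using hr.sum_eq_one y

/-- The full-correlation functionals with coefficients `c_y` witness that `C` is an XOR
connector. -/
def HasXORCoeffs (C : ConnTensor m n) (c : Fin n → RealTensor fun k => Fin (m k)) : Prop :=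
  ∀ (H : ι → Type u) [∀ k, NormedAddCommGroup (H k)] [∀ k, InnerProductSpace ℂ (H k)]
    [∀ k, CompleteSpace (H k)] (A : ∀ k, Leg (m k) → H k →L[ℂ] H k),
    (∀ k, IsMeasurement (A k)) → ∀ y,
      dichotomic (C.op A) y = RealTensor.op (c y) fun k => dichotomic (A k)

namespace HasXORCoeffs

variable {c : Fin n → RealTensor fun k => Fin (m k)}

theorem meanOutcome_eval (hc : HasXORCoeffs.{u} C c) {r : ∀ k, Leg (m k) → ℝ}
    (h : ∀ k, IsResponse (r k)) (y : Fin n) :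
    meanOutcome (C.eval r) y = RealTensor.eval (c y) fun k => meanOutcome (r k) := by
  have hop := hc (fun _ => ScalarSpace.{u}) _ (fun k => (h k).isMeasurement_smul_one) y
  rw [op_smul_one, dichotomic_smul_one, funext₂ fun k x => dichotomic_smul_one (r k) x,
    RealTensor.op_smul_one] at hop
  exact Complex.ofReal_injective (smul_left_injective ℂ one_ne_zero hop)

variable [∀ k, CompleteSpace (H k)] {A : ∀ k, Leg (m k) → H k →L[ℂ] H k}

theorem dichotomic_op_flipOutcome (hc : HasXORCoeffs.{u} C c) (hA : ∀ k, IsMeasurement (A k))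
    (s : ι → ℤˣ) (y : Fin n) :
    dichotomic (C.op fun k => flipOutcome (s k) (A k)) y
      = ((∏ k, ((s k : ℤ) : ℝ) : ℝ) : ℂ) • dichotomic (C.op A) y := by
  rw [hc H _ fun k => (hA k).flipOutcome (s k), hc H A hA, ← RealTensor.op_smul]
  exact congrArg _ (funext₂ fun k => dichotomic_flipOutcome (s k) (A k))

theorem exists_isMeasurement_dichotomic_op_eq_neg [Nonempty ι] (hc : HasXORCoeffs.{u} C c)
    (hA : ∀ k, IsMeasurement (A k)) (y : Fin n) :
    ∃ A' : ∀ k, Leg (m k) → H k →L[ℂ] H k, (∀ k, IsMeasurement (A' k)) ∧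
      dichotomic (C.op A') y = -dichotomic (C.op A) y := by
  let s : ι → ℤˣ := Pi.mulSingle (Classical.arbitrary ι) (-1)
  refine ⟨fun k => flipOutcome (s k) (A k), fun k => (hA k).flipOutcome (s k), ?_⟩
  have hs : ∏ k, s k = -1 := Fintype.prod_pi_mulSingle' _ _
  rw [hc.dichotomic_op_flipOutcome hA, ← Int.cast_prod, ← Units.coe_prod, hs]
  simp

end HasXORCoeffs

end ConnTensor

end Connectors

section QuantumValues

open scoped InnerProductSpace InnerProduct

universe u

variable {ι : Type} [Fintype ι] {m : ι → ℕ} {n : ℕ} {H : ι → Type u}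
  [∀ k, NormedAddCommGroup (H k)] [∀ k, InnerProductSpace ℂ (H k)]
  {A : ∀ k, Leg (m k) → H k →L[ℂ] H k}

/-- The behaviour of parties who measure the systems `A` on the pure state `ψ`. -/
noncomputable def pureBehaviour (A : ∀ k, Leg (m k) → H k →L[ℂ] H k) (ψ : HilbertTensor H) :
    Behaviour m :=
  fun z => (⟪ψ, HilbertTensor.map (fun k => A k (z k)) ψ⟫_ℂ).re

theorem isQuantum_pureBehaviour [∀ k, CompleteSpace (H k)] (hA : ∀ k, IsMeasurement (A k))
    {ψ : HilbertTensor H} (hψ : ‖ψ‖ = 1) : IsQuantum.{u} (pureBehaviour A ψ) := by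
  refine ⟨H, _, _, inferInstance, A, Pi.single 0 1, fun _ => ψ, hA, ?_, hasSum_pi_single 0 1,
    fun _ => hψ, fun z => ?_⟩
  · exact (Pi.single_nonneg (α := fun _ : ℕ => ℝ)).2 zero_le_one
  · have hreal : (pureBehaviour A ψ z : ℂ) = ⟪ψ, HilbertTensor.map (fun k => A k (z k)) ψ⟫_ℂ := by
      refine Complex.conj_eq_iff_re.1 ?_
      rw [inner_conj_symm, ← ContinuousLinearMap.adjoint_inner_right, HilbertTensor.adjoint_map]
      simp only [((hA _).isPositive _).isSelfAdjoint.adjoint_eq]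
    rw [hreal]
    convert hasSum_pi_single (0 : ℕ) ⟪ψ, HilbertTensor.map (fun k => A k (z k)) ψ⟫_ℂ using 2 with j
    by_cases hj : j = 0 <;> simp [hj]

variable [DecidableEq ι] {C : ConnTensor m n}

namespace ConnTensor

theorem value_pureBehaviour (C : ConnTensor m n) (A : ∀ k, Leg (m k) → H k →L[ℂ] H k)
    (ψ : HilbertTensor H) (y : Fin n) :
    C.value y (pureBehaviour A ψ) = (⟪ψ, dichotomic (C.op A) y ψ⟫_ℂ).re := by
  rw [value_eq_meanOutcome, ← meanOutcome_inner]
  congr 1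
  funext e
  simp only [pureBehaviour, op, sum_apply, smul_apply, inner_sum, inner_smul_right, Complex.re_sum,
    Complex.re_ofReal_mul]

theorem IsConnector.abs_value_le_one (hC : IsConnector.{u} C) (y : Fin n) {P : Behaviour m}
    (hP : IsQuantum.{u} P) : |C.value y P| ≤ 1 := by
  obtain ⟨H, _, _, _, A, p, ψ, hA, hp0, hp1, hψ, hP⟩ := hP
  have hvalue : HasSum (fun j => p j * C.value y (pureBehaviour A (ψ j))) (C.value y P) := by
    have hmix := C.hasSum_value y (P := P) (Q := fun j z => p j * pureBehaviour A (ψ j) z)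
      fun z => by simpa [pureBehaviour] using Complex.hasSum_re (hP z)
    refine hmix.congr_fun fun j => ?_
    simp only [value, Finset.mul_sum, mul_left_comm]
  have hpure (j) : |C.value y (pureBehaviour A (ψ j))| ≤ 1 := by
    rw [value_pureBehaviour, ← meanOutcome_inner]
    exact ((hC H A hA).isResponse_inner (hψ j)).abs_meanOutcome_le y
  have hterm (j) : |p j * C.value y (pureBehaviour A (ψ j))| ≤ p j := by
    rw [abs_mul, abs_of_nonneg (hp0 j)]
    exact mul_le_of_le_one_right (hp0 j) (hpure j)
  exact abs_le.2 ⟨hasSum_le (fun j => (abs_le.1 (hterm j)).1) hp1.neg hvalue,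
    hasSum_le (fun j => (abs_le.1 (hterm j)).2) hvalue hp1⟩

end ConnTensor

end QuantumValues

section Contraction

universe u

variable {ι : Type} [Fintype ι] [DecidableEq ι] {κ : ι → Type} [∀ k, Fintype (κ k)]
  [∀ k, DecidableEq (κ k)] {m : ι → ℕ} {n : ℕ} {s : ∀ k, κ k → ℕ}

namespace ConnTensor

/-- The connector `C` with the output leg of `B k` plugged into its incoming leg `k`. -/
def comp (C : ConnTensor m n) (B : ∀ k, ConnTensor (s k) (m k)) :
    ConnTensor (fun l : Σ k, κ k => s l.1 l.2) n :=
  fun e => RealTensor.comp (C e) B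

variable {C : ConnTensor m n} {B : ∀ k, ConnTensor (s k) (m k)}

theorem eval_comp (r : ∀ l : Σ k, κ k, Leg (s l.1 l.2) → ℝ) :
    (C.comp B).eval r = C.eval fun k => (B k).eval fun l => r ⟨k, l⟩ :=
  funext fun e => RealTensor.eval_comp (τ := fun l => Leg (s l.1 l.2)) (C e) B r

theorem conjStarAlgEquiv_sigmaEquiv_op_comp {L : (Σ k, κ k) → Type u}
    [∀ l, NormedAddCommGroup (L l)] [∀ l, InnerProductSpace ℂ (L l)]
    (A : ∀ l : Σ k, κ k, Leg (s l.1 l.2) → L l →L[ℂ] L l) (e : Leg n) :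
    (HilbertTensor.sigmaEquiv L).conjStarAlgEquiv ((C.comp B).op A e)
      = C.op (fun k => (B k).op fun l => A ⟨k, l⟩) e :=
  RealTensor.conjStarAlgEquiv_sigmaEquiv_op_comp (τ := fun l => Leg (s l.1 l.2)) (C e) B A

theorem IsConnector.comp (hC : IsConnector.{u} C) (hB : ∀ k, IsConnector.{u} (B k)) :
    IsConnector.{u} (C.comp B) := by
  intro H _ _ _ A hA
  refine .of_conjStarAlgEquiv (HilbertTensor.sigmaEquiv H) ?_
  simp only [conjStarAlgEquiv_sigmaEquiv_op_comp]
  exact hC _ _ fun k => hB k _ _ fun l => hA ⟨k, l⟩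

theorem HasXORCoeffs.comp {c : Fin n → RealTensor fun k => Fin (m k)}
    {b : ∀ k, Fin (m k) → RealTensor fun l => Fin (s k l)} (hc : HasXORCoeffs.{u} C c)
    (hb : ∀ k, HasXORCoeffs.{u} (B k) (b k)) (hB : ∀ k, IsConnector.{u} (B k)) :
    HasXORCoeffs.{u} (C.comp B) fun y => RealTensor.comp (c y) b := by
  intro H _ _ _ A hA y
  apply EquivLike.injective (HilbertTensor.sigmaEquiv H).conjStarAlgEquiv
  rw [RealTensor.conjStarAlgEquiv_sigmaEquiv_op_comp (τ := fun l => Fin (s l.1 l.2)),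
    dichotomic, map_sub, conjStarAlgEquiv_sigmaEquiv_op_comp,
    conjStarAlgEquiv_sigmaEquiv_op_comp, ← dichotomic,
    hc _ _ fun k => hB k _ _ fun l => hA ⟨k, l⟩]
  exact congrArg _ (funext₂ fun k => hb k _ _ fun l => hA ⟨k, l⟩)

end ConnTensor

end Contraction

section Dilations

open scoped InnerProduct

universe u

namespace ConnTensor

theorem op_compress {ι : Type} [Fintype ι] [DecidableEq ι] {m : ι → ℕ} {n : ℕ}
    {H K : ι → Type u} [∀ k, NormedAddCommGroup (H k)] [∀ k, InnerProductSpace ℂ (H k)]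
    [∀ k, CompleteSpace (H k)] [∀ k, NormedAddCommGroup (K k)] [∀ k, InnerProductSpace ℂ (K k)]
    [∀ k, CompleteSpace (K k)] (C : ConnTensor m n) (A : ∀ k, Leg (m k) → H k →L[ℂ] H k)
    (V : ∀ k, H k →L[ℂ] K k) (e : Leg n) :
    C.op (fun k e => V k ∘L A k e ∘L (V k)†) e
      = HilbertTensor.map V ∘L C.op A e ∘L (HilbertTensor.map V)† :=
  RealTensor.op_compress (C e) A V

/-- Measurements `A` of the parties and a coisometry `V` with `V C_{b|y}[A] V† = B_{b|y}`. A
connector complex is a dilation of its renormalized measurements `M̄`. -/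
structure Dilation {ι : Type} [Fintype ι] [DecidableEq ι] {m : ι → ℕ} {n : ℕ}
    (C : ConnTensor m n) {E : Type u} [NormedAddCommGroup E] [InnerProductSpace ℂ E]
    [CompleteSpace E] (B : Leg n → E →L[ℂ] E) where
  H : ι → Type u
  [normedH : ∀ k, NormedAddCommGroup (H k)]
  [innerH : ∀ k, InnerProductSpace ℂ (H k)]
  [completeH : ∀ k, CompleteSpace (H k)]
  A : ∀ k, Leg (m k) → H k →L[ℂ] H k
  V : HilbertTensor H →L[ℂ] E
  isMeasurement : ∀ k, IsMeasurement (A k)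
  isCoisometry : IsCoisometry V
  compress_op : ∀ e, V ∘L C.op A e ∘L V† = B e

attribute [instance] Dilation.normedH Dilation.innerH Dilation.completeH

namespace Dilation

variable {ι : Type} [Fintype ι] [DecidableEq ι] {m : ι → ℕ} {n : ℕ} {C : ConnTensor m n}
  {E : Type u} [NormedAddCommGroup E] [InnerProductSpace ℂ E] [CompleteSpace E]
  {B : Leg n → E →L[ℂ] E}

/-- Transport of a dilation along a unitary. -/
noncomputable def ofUnitary {F : Type u} [NormedAddCommGroup F] [InnerProductSpace ℂ F]
    [CompleteSpace F] {B' : Leg n → F →L[ℂ] F} (R : Dilation C B) (U : E ≃ₗᵢ[ℂ] F)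
    (h : ∀ e φ, B' e (U φ) = U (B e φ)) : Dilation C B' where
  H := R.H
  A := R.A
  V := (U : E →L[ℂ] F) ∘L R.V
  isMeasurement := R.isMeasurement
  isCoisometry := (IsCoisometry.coe_linearIsometryEquiv U).comp R.isCoisometry
  compress_op e := by
    ext φ
    have := congr($(R.compress_op e) (U.symm φ))
    simp_all [ContinuousLinearMap.adjoint_comp, LinearIsometryEquiv.adjoint_eq_symm, ← h]

/-- Contraction of dilations: the coisometries of the children are applied before the coisometry
of the root. -/
noncomputable def comp {κ : ι → Type} [∀ k, Fintype (κ k)] [∀ k, DecidableEq (κ k)]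
    {s : ∀ k, κ k → ℕ} {D : ∀ k, ConnTensor (s k) (m k)} (R : Dilation C B)
    (S : ∀ k, Dilation (D k) (R.A k)) : Dilation (C.comp D) B where
  H l := (S l.1).H l.2
  A l := (S l.1).A l.2
  V := R.V ∘L HilbertTensor.map (fun k => (S k).V) ∘L
    (HilbertTensor.sigmaEquiv fun l : Σ k, κ k => (S l.1).H l.2 : _ →L[ℂ] _)
  isMeasurement l := (S l.1).isMeasurement l.2
  isCoisometry := R.isCoisometry.comp <|
    (IsCoisometry.map fun k => (S k).isCoisometry).comp (.coe_linearIsometryEquiv _)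
  compress_op e := by
    have hS : C.op (fun k e => (S k).V ∘L (D k).op (S k).A e ∘L ((S k).V)†) e = C.op R.A e :=
      congrArg (C.op · e) (funext₂ fun k => (S k).compress_op)
    have hW := conjStarAlgEquiv_sigmaEquiv_op_comp (C := C) (B := D)
      (fun l : Σ k, κ k => (S l.1).A l.2) e
    rw [LinearIsometryEquiv.conjStarAlgEquiv_apply, ← LinearIsometryEquiv.adjoint_eq_symm] at hW
    rw [← R.compress_op e, ← hS, op_compress, ← hW]
    simp only [ContinuousLinearMap.adjoint_comp, ContinuousLinearMap.comp_assoc]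

end Dilation

end ConnTensor

end Dilations

section ClassicalRatio

universe u

variable {ι : Type} [Fintype ι] [DecidableEq ι] {m : ι → ℕ} {n : ℕ} {C : ConnTensor m n}

namespace ConnTensor

theorem HasXORCoeffs.exists_isClassical_value_pos [Nonempty ι]
    {c : Fin n → RealTensor fun k => Fin (m k)} (hc : HasXORCoeffs.{u} C c) {y : Fin n}
    (hy : c y ≠ 0) : ∃ P, IsClassical P ∧ 0 < C.value y P := by
  obtain ⟨x, hx⟩ := Function.ne_iff.1 hy
  let i := Classical.arbitrary ι
  let a : ι → ℝ := Pi.mulSingle i (SignType.sign (c y x) : ℝ)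
  have ha (k) : |a k| ≤ 1 := by
    obtain rfl | hk := eq_or_ne k i
    · rcases lt_trichotomy (c y x) 0 with h | h | h <;> simp [a, h]
    · simp [a, hk]
  have hmean (k) : ∃ r, IsResponse r ∧
      meanOutcome r = fun x' => a k * Pi.single (M := fun _ => ℝ) (x k) 1 x' :=
    exists_isResponse_meanOutcome_eq fun x' => by
      by_cases h : x' = x k <;> simp [h, ha]
  choose r hr hmean using hmean
  refine ⟨_, isClassical_prod hr, ?_⟩
  rw [value_prod, hc.meanOutcome_eval hr, funext hmean, RealTensor.eval_smul,
    RealTensor.eval_apply_single, Fintype.prod_pi_mulSingle', sign_mul_self]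
  exact abs_pos.2 hx

theorem IsConnector.abs_value_le_one_of_isClassical (hC : IsConnector.{u} C) (y : Fin n)
    {P : Behaviour m} (hP : IsClassical P) : |C.value y P| ≤ 1 :=
  hP.abs_value_le fun _ hr => (hC.isResponse_eval hr).abs_meanOutcome_le y

theorem IsConnector.one_mem_classicalFactors (hC : IsConnector.{u} C) :
    (1 : ℝ) ∈ C.classicalFactors := fun y P hP => by
  simpa only [one_mul] using abs_le.1 (hC.abs_value_le_one_of_isClassical y hP)

theorem isClosed_classicalFactors (C : ConnTensor m n) : IsClosed C.classicalFactors := by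
  simp only [classicalFactors, Set.ofPred_forall]
  refine isClosed_iInter fun y => isClosed_iInter fun P => isClosed_iInter fun _ => ?_
  exact isClosed_Icc.preimage (continuous_mul_const (C.value y P))

theorem IsConnector.isGreatest_gamma (hC : IsConnector.{u} C) {y : Fin n} {P : Behaviour m}
    (hP : IsClassical P) (hv : 0 < C.value y P) : IsGreatest C.classicalFactors C.gamma :=
  C.isClosed_classicalFactors.isGreatest_csSup ⟨1, hC.one_mem_classicalFactors⟩
    ⟨1 / C.value y P, fun _ hg => (le_div_iff₀ hv).2 (hg y P hP).2⟩

end ConnTensor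

end ClassicalRatio

section Attainment

open scoped InnerProductSpace InnerProduct

universe u

variable {ι : Type} [Fintype ι] [DecidableEq ι] {m : ι → ℕ} {n : ℕ} {C : ConnTensor m n}
  {E : Type u} [NormedAddCommGroup E] [InnerProductSpace ℂ E] [CompleteSpace E]
  {B : Leg n → E →L[ℂ] E}

namespace ConnTensor.Dilation

theorem compress_dichotomic_op (R : Dilation C B) (y : Fin n) :
    R.V ∘L dichotomic (C.op R.A) y ∘L (R.V)† = dichotomic B y := by
  rw [← dichotomic_compress, funext R.compress_op]

variable [Nontrivial E]

theorem coeff_ne_zero (R : Dilation C B) (hB : IsProjectiveMeasurement B)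
    {c : Fin n → RealTensor fun k => Fin (m k)} (hc : HasXORCoeffs.{u} C c) (y : Fin n) :
    c y ≠ 0 := by
  intro hy
  have hzero : dichotomic B y = 0 := by
    rw [← R.compress_dichotomic_op, hc _ _ R.isMeasurement, hy]
    simp [RealTensor.op]
  simpa [hzero] using hB.dichotomic_mul_self y

theorem exists_isQuantum_value_eq [Nonempty ι] (R : Dilation C B)
    (hB : IsProjectiveMeasurement B) (hC : IsXOR.{u} C) (y : Fin n) :
    (∃ P, IsQuantum.{u} P ∧ C.value y P = -1) ∧ ∃ P, IsQuantum.{u} P ∧ C.value y P = 1 := by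
  obtain ⟨c, hc⟩ : ∃ c, HasXORCoeffs.{u} C c := hC
  obtain ⟨A', hA', hneg⟩ := hc.exists_isMeasurement_dichotomic_op_eq_neg R.isMeasurement y
  obtain ⟨φ, hφ, heigen⟩ := hB.exists_dichotomic_eigenvector y
  let ψ := (R.V†) φ
  have hψ : ‖ψ‖ = 1 := (R.isCoisometry.norm_adjoint_apply φ).trans hφ
  have hinner : ⟪ψ, dichotomic (C.op R.A) y ψ⟫_ℂ = ⟪φ, dichotomic B y φ⟫_ℂ := by
    rw [← R.compress_dichotomic_op, ContinuousLinearMap.adjoint_inner_left]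
    rfl
  have hplus := isQuantum_pureBehaviour R.isMeasurement hψ
  have hminus := isQuantum_pureBehaviour hA' hψ
  rcases heigen with h | h
  · refine ⟨⟨_, hminus, ?_⟩, _, hplus, ?_⟩ <;>
      simp [value_pureBehaviour, hneg, hinner, h, hφ]
  · refine ⟨⟨_, hplus, ?_⟩, _, hminus, ?_⟩ <;>
      simp [value_pureBehaviour, hneg, hinner, h, hφ]

end ConnTensor.Dilation

/-- A connector complex as a dilation of its renormalized measurements. -/
noncomputable def ConnectorComplex.dilation (D : ConnectorComplex.{u}) :
    D.C.Dilation D.M where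
  H := D.H
  A := D.A
  V := D.V
  isMeasurement := D.isMeasurement
  isCoisometry := D.coisometry
  compress_op _ := rfl

namespace XORComplex

variable (D : XORComplex.{u})

theorem isGreatest_gamma (y : Fin D.n) : IsGreatest D.C.classicalFactors D.C.gamma := by
  obtain ⟨c, hc⟩ : ∃ c, ConnTensor.HasXORCoeffs.{u} D.C c := D.isXOR
  have : Nonempty (Fin D.q) := ⟨0, D.q_pos⟩
  obtain ⟨P, hP, hv⟩ :=
    hc.exists_isClassical_value_pos (D.dilation.coeff_ne_zero D.isProjective hc y)
  exact D.isConnector.isGreatest_gamma hP hv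

theorem one_le_gamma (y : Fin D.n) : 1 ≤ D.C.gamma :=
  (D.isGreatest_gamma y).2 D.isConnector.one_mem_classicalFactors

end XORComplex

end Attainment

section OpenLegs

universe u

namespace ConnTensor

/-- The identity tensor, carried by an open leg. -/
def idTensor (n : ℕ) : ConnTensor (fun _ : Unit => n) n :=
  fun e z => (1 : Matrix (Leg n) (Leg n) ℝ) e (z ())

variable {n : ℕ}

theorem idTensor_eq_single (e : Leg n) : idTensor n e = Pi.single (fun _ => e) 1 := by
  funext z
  simp [idTensor, Matrix.one_apply, Pi.single_apply, funext_iff, Unique.forall_iff,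
    eq_comm (a := e)]

theorem eval_idTensor (r : ∀ _ : Unit, Leg n → ℝ) : (idTensor n).eval r = r () := by
  funext e
  simp [eval, idTensor_eq_single, RealTensor.eval_single]

variable {H : Unit → Type u} [∀ k, NormedAddCommGroup (H k)] [∀ k, InnerProductSpace ℂ (H k)]

theorem op_idTensor (A : ∀ k, Leg n → H k →L[ℂ] H k) (e : Leg n) :
    (idTensor n).op A e = HilbertTensor.map fun k => A k e := by
  rw [← RealTensor.op_single (fun _ => e) A, ← idTensor_eq_single]
  rfl

variable [∀ k, CompleteSpace (H k)]

theorem conjStarAlgEquiv_unitEquiv_op_idTensor (A : ∀ k, Leg n → H k →L[ℂ] H k) (e : Leg n) :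
    (HilbertTensor.unitEquiv H).conjStarAlgEquiv ((idTensor n).op A e) = A () e := by
  rw [op_idTensor, HilbertTensor.conjStarAlgEquiv_unitEquiv_map]

theorem isConnector_idTensor : IsConnector.{u} (idTensor n) := by
  intro H _ _ _ A hA
  refine .of_conjStarAlgEquiv (HilbertTensor.unitEquiv H) ?_
  simpa only [conjStarAlgEquiv_unitEquiv_op_idTensor] using hA ()

theorem hasXORCoeffs_idTensor :
    HasXORCoeffs.{u} (idTensor n) fun y => Pi.single (fun _ => y) 1 := by
  intro H _ _ _ A _ y
  apply EquivLike.injective (HilbertTensor.unitEquiv H).conjStarAlgEquiv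
  rw [RealTensor.op_single, HilbertTensor.conjStarAlgEquiv_unitEquiv_map, dichotomic, map_sub,
    conjStarAlgEquiv_unitEquiv_op_idTensor, conjStarAlgEquiv_unitEquiv_op_idTensor, dichotomic]

/-- An open leg dilates every system of measurements, which its only party performs. -/
noncomputable def Dilation.idTensor {E : Type u} [NormedAddCommGroup E] [InnerProductSpace ℂ E]
    [CompleteSpace E] {B : Leg n → E →L[ℂ] E} (hB : IsMeasurement B) :
    Dilation (ConnTensor.idTensor n) B where
  H _ := E
  A _ := B
  V := (HilbertTensor.unitEquiv fun _ => E : _ →L[ℂ] E)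
  isMeasurement _ := hB
  isCoisometry := .coe_linearIsometryEquiv _
  compress_op e := by
    rw [LinearIsometryEquiv.adjoint_eq_symm]
    exact conjStarAlgEquiv_unitEquiv_op_idTensor (fun _ => B) e

end ConnTensor

end OpenLegs

section Networks

universe u

section Amplification

variable {ι : Type} [Fintype ι] [DecidableEq ι] {m : ι → ℕ} {n : ℕ} {C : ConnTensor m n}

theorem ConnTensor.abs_mul_meanOutcome_eval_le_one (hC : ConnTensor.IsXOR.{u} C) {g : ℝ}
    (hg : g ∈ C.classicalFactors) {a : ι → ℝ} {r : ∀ k, Leg (m k) → ℝ}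
    (hr : ∀ k, IsResponse (r k)) (ha : ∀ k x, |a k * meanOutcome (r k) x| ≤ 1) (y : Fin n) :
    |(g * ∏ k, a k) * meanOutcome (C.eval r) y| ≤ 1 := by
  obtain ⟨c, hc⟩ : ∃ c, HasXORCoeffs.{u} C c := hC
  choose r' hr' hmean using fun k => exists_isResponse_meanOutcome_eq (ha k)
  have hscale : meanOutcome (C.eval r') y = (∏ k, a k) * meanOutcome (C.eval r) y := by
    rw [hc.meanOutcome_eval hr', hc.meanOutcome_eval hr, funext hmean, RealTensor.eval_smul]
  rw [mul_assoc, ← hscale, ← C.value_prod]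
  exact abs_le.2 (hg y _ (isClassical_prod hr'))

end Amplification

namespace Network

variable {n : ℕ} (T : Network.{u} n)

theorem isConnector_tensor : ConnTensor.IsConnector.{u} T.tensor := by
  induction T with
  | wire n => exact ConnTensor.isConnector_idTensor
  | node D child ih => exact D.isConnector.comp ih

theorem isXOR_tensor : ConnTensor.IsXOR.{u} T.tensor := by
  induction T with
  | wire n => exact ⟨_, ConnTensor.hasXORCoeffs_idTensor⟩
  | node D child ih =>
    choose b hb using ih
    obtain ⟨c, hc⟩ := D.isXOR
    exact ⟨_, ConnTensor.HasXORCoeffs.comp hc hb fun k => (child k).isConnector_tensor⟩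

instance instNonemptyLeaf : Nonempty T.Leaf := by
  induction T with
  | wire n => exact ⟨()⟩
  | node D child ih => exact ⟨⟨⟨0, D.q_pos⟩, (ih _).some⟩⟩

section Quantum

theorem exists_isProjectiveMeasurement_outputIs :
    ∃ (E : Type u) (_ : NormedAddCommGroup E) (_ : InnerProductSpace ℂ E) (_ : CompleteSpace E)
      (B : Leg n → E →L[ℂ] E), Nontrivial E ∧ IsProjectiveMeasurement B ∧ T.OutputIs B := by
  cases T with
  | wire n =>
    refine ⟨ScalarSpace.{u}, inferInstance, inferInstance, inferInstance,
      fun e => if e.1 = 1 then 1 else 0, inferInstance, ⟨fun e => ?_, fun x => ?_⟩, trivial⟩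
    · split_ifs
      exacts [.one _, .zero _]
    · simp
  | node D child =>
    exact ⟨D.Hout, inferInstance, inferInstance, inferInstance, D.M, inferInstance,
      D.isProjective, .refl ℂ D.Hout, fun _ _ => rfl⟩

variable {T}

theorem IsCongruent.nonempty_dilation (hT : T.IsCongruent) {E : Type u} [NormedAddCommGroup E]
    [InnerProductSpace ℂ E] [CompleteSpace E] {B : Leg n → E →L[ℂ] E} (hB : IsMeasurement B)
    (h : T.OutputIs B) : Nonempty (T.tensor.Dilation B) := by
  induction T generalizing E with
  | wire n => exact ⟨.idTensor hB⟩
  | node D child ih =>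
    have S k := (ih k (hT k).2 (D.isMeasurement k) (hT k).1).some
    obtain ⟨U, hU⟩ := h
    exact ⟨(D.dilation.comp S).ofUnitary U hU⟩

theorem IsCongruent.exists_isQuantum_value_eq (hT : T.IsCongruent) (y : Fin n) :
    (∃ P, IsQuantum.{u} P ∧ T.tensor.value y P = -1) ∧
      ∃ P, IsQuantum.{u} P ∧ T.tensor.value y P = 1 := by
  obtain ⟨E, _, _, _, B, _, hB, hout⟩ := T.exists_isProjectiveMeasurement_outputIs
  obtain ⟨R⟩ := hT.nonempty_dilation hB.isMeasurement hout
  exact R.exists_isQuantum_value_eq hB T.isXOR_tensor y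

theorem IsCongruent.quantumMax_eq_one (hT : T.IsCongruent) (y : Fin n) :
    ConnTensor.quantumMax.{u} T.tensor y = 1 := by
  refine IsGreatest.csSup_eq ⟨(hT.exists_isQuantum_value_eq y).2, ?_⟩
  rintro _ ⟨P, hP, rfl⟩
  exact (abs_le.1 (T.isConnector_tensor.abs_value_le_one y hP)).2

theorem IsCongruent.classicalMax_pos (hT : T.IsCongruent) (y : Fin n) :
    0 < T.tensor.classicalMax y := by
  obtain ⟨E, _, _, _, B, _, hB, hout⟩ := T.exists_isProjectiveMeasurement_outputIs
  obtain ⟨R⟩ := hT.nonempty_dilation hB.isMeasurement hout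
  obtain ⟨c, hc⟩ : ∃ c, ConnTensor.HasXORCoeffs.{u} T.tensor c := T.isXOR_tensor
  obtain ⟨P, hP, hpos⟩ := hc.exists_isClassical_value_pos (R.coeff_ne_zero hB hc y)
  refine hpos.trans_le (le_csSup ⟨1, ?_⟩ ⟨P, hP, rfl⟩)
  rintro _ ⟨Q, hQ, rfl⟩
  exact (abs_le.1 (T.isConnector_tensor.abs_value_le_one_of_isClassical y hQ)).2

end Quantum

section Classical

theorem nonempty_settings_complexAt (y : Fin n) (v : T.Node) :
    Nonempty (Fin (T.complexAt v).n) := by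
  induction T with
  | wire n => exact v.elim
  | node D child ih =>
    rcases v with _ | ⟨k, w⟩
    · exact ⟨y⟩
    · exact ih k ⟨0, D.isConnector.settings_pos y k⟩ w

theorem isGreatest_gamma_complexAt (y : Fin n) (v : T.Node) :
    IsGreatest (T.complexAt v).C.classicalFactors (T.complexAt v).C.gamma :=
  let ⟨y'⟩ := T.nonempty_settings_complexAt y v
  (T.complexAt v).isGreatest_gamma y'

theorem bigGamma_pos (y : Fin n) : 0 < T.bigGamma :=
  Finset.prod_pos fun v _ =>
    let ⟨y'⟩ := T.nonempty_settings_complexAt y v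
    zero_lt_one.trans_le ((T.complexAt v).one_le_gamma y')

theorem bigGamma_wire (n : ℕ) : (wire.{u} n).bigGamma = 1 :=
  Finset.prod_empty

theorem bigGamma_node (D : XORComplex.{u}) (child : ∀ k : Fin D.q, Network (D.m k)) :
    (node D child).bigGamma = D.C.gamma * ∏ k, (child k).bigGamma :=
  (Fintype.prod_option _).trans (congrArg _ (Fintype.prod_sigma _))

theorem abs_bigGamma_mul_meanOutcome_eval_le_one (y : Fin n)
    {r : ∀ l, Leg (T.settings l) → ℝ} (hr : ∀ l, IsResponse (r l)) :
    |T.bigGamma * meanOutcome (T.tensor.eval r) y| ≤ 1 := by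
  induction T with
  | wire n =>
    have heval : (wire.{u} n).tensor.eval r = r () := ConnTensor.eval_idTensor r
    rw [bigGamma_wire, heval, one_mul]
    exact (hr ()).abs_meanOutcome_le y
  | node D child ih =>
    have heval : (node D child).tensor.eval r
        = D.C.eval fun k => (child k).tensor.eval fun l => r ⟨k, l⟩ :=
      ConnTensor.eval_comp (B := fun k => (child k).tensor) r
    rw [bigGamma_node, heval]
    exact ConnTensor.abs_mul_meanOutcome_eval_le_one D.isXOR (D.isGreatest_gamma y).1
      (fun k => (child k).isConnector_tensor.isResponse_eval fun l => hr ⟨k, l⟩)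
      (fun k x => ih k x fun l => hr ⟨k, l⟩) y

theorem abs_value_le_of_isClassical (y : Fin n) {P : Behaviour T.settings}
    (hP : IsClassical P) : |T.tensor.value y P| ≤ 1 / T.bigGamma := by
  have hpos := T.bigGamma_pos y
  refine hP.abs_value_le fun r hr => (le_div_iff₀' hpos).2 ?_
  simpa only [abs_mul, abs_of_pos hpos] using T.abs_bigGamma_mul_meanOutcome_eval_le_one y hr

theorem classicalMax_le_inv_bigGamma (y : Fin n) : T.tensor.classicalMax y ≤ T.bigGamma⁻¹ := by
  refine Real.sSup_le ?_ (inv_nonneg.2 (T.bigGamma_pos y).le)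
  rintro _ ⟨P, hP, rfl⟩
  exact (le_abs_self _).trans (one_div T.bigGamma ▸ T.abs_value_le_of_isClassical y hP)

variable {T}

theorem IsCongruent.bigGamma_le_quantumMax_div_classicalMax (hT : T.IsCongruent) (y : Fin n) :
    T.bigGamma ≤ ConnTensor.quantumMax.{u} T.tensor y / T.tensor.classicalMax y := by
  rw [hT.quantumMax_eq_one, one_div]
  exact (le_inv_comm₀ (T.bigGamma_pos y) (hT.classicalMax_pos y)).2
    (T.classicalMax_le_inv_bigGamma y)

theorem pow_card_node_le_bigGamma {γ₀ : ℝ} (hγ₀ : 0 ≤ γ₀)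
    (hγ : ∀ v, γ₀ ≤ (T.complexAt v).C.gamma) :
    γ₀ ^ Fintype.card T.Node ≤ T.bigGamma := by
  rw [bigGamma, ← Finset.card_univ, ← Finset.prod_const]
  exact Finset.prod_le_prod (fun _ _ => hγ₀) fun v _ => hγ v

end Classical

section Counting

variable {T} {q : ℕ}

theorem card_leaf_le (hq : 1 ≤ q) (h : ∀ v, (T.complexAt v).q ≤ q) :
    Fintype.card T.Leaf ≤ 1 + Fintype.card T.Node * (q - 1) := by
  induction T with
  | wire n => exact le_of_eq_of_le Fintype.card_unit (Nat.le_add_right _ _)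
  | node D child ih =>
    have hleaf : Fintype.card (node D child).Leaf = ∑ k, Fintype.card (child k).Leaf :=
      Fintype.card_sigma
    have hnode : Fintype.card (node D child).Node = (∑ k, Fintype.card (child k).Node) + 1 :=
      Fintype.card_option.trans (congrArg (· + 1) Fintype.card_sigma)
    have hroot : D.q ≤ q := h none
    calc Fintype.card (node D child).Leaf
        ≤ ∑ k, (1 + Fintype.card (child k).Node * (q - 1)) :=
          hleaf.trans_le (Finset.sum_le_sum fun k _ => ih k fun v => h (some ⟨k, v⟩))
      _ = D.q + (∑ k, Fintype.card (child k).Node) * (q - 1) := by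
          simp [Finset.sum_add_distrib, Finset.sum_mul]
      _ ≤ 1 + Fintype.card (node D child).Node * (q - 1) := by
          rw [hnode, add_mul]
          omega

theorem card_leaf_sub_one_div_le (hq : 2 ≤ q) (h : ∀ v, (T.complexAt v).q ≤ q) :
    ((Fintype.card T.Leaf : ℝ) - 1) / ((q : ℝ) - 1) ≤ Fintype.card T.Node := by
  have hq1 : 1 < q := hq
  rw [div_le_iff₀ (sub_pos.2 (Nat.one_lt_cast.2 hq1)), sub_le_iff_le_add',
    ← Nat.cast_pred (by omega)]
  exact_mod_cast card_leaf_le hq1.le h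

end Counting

end Network

end Networks

universe u

theorem mainTheorem2 {n : ℕ} (T : Network.{u} n) (hT : T.IsCongruent) (y : Fin n) :
    (∀ P : Behaviour T.settings, IsQuantum.{u} P →
      -1 ≤ T.tensor.value y P ∧ T.tensor.value y P ≤ 1) ∧
    (∃ P : Behaviour T.settings, IsQuantum.{u} P ∧ T.tensor.value y P = -1) ∧
    (∃ P : Behaviour T.settings, IsQuantum.{u} P ∧ T.tensor.value y P = 1) ∧
    (∀ v : T.Node, IsGreatest (T.complexAt v).C.classicalFactors (T.complexAt v).C.gamma) ∧
    (∀ P : Behaviour T.settings, IsClassical P →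
      -(1 / T.bigGamma) ≤ T.tensor.value y P ∧ T.tensor.value y P ≤ 1 / T.bigGamma) ∧
    (∀ γ₀ : ℝ, 1 < γ₀ → (∀ v : T.Node, γ₀ ≤ (T.complexAt v).C.gamma) →
      T.tensor.classicalMax y ≤ (γ₀ ^ Fintype.card T.Node)⁻¹ ∧
      γ₀ ^ Fintype.card T.Node ≤
        ConnTensor.quantumMax.{u} T.tensor y / T.tensor.classicalMax y ∧
      ∀ qbar : ℕ, 2 ≤ qbar → (∀ v : T.Node, (T.complexAt v).q ≤ qbar) →
        ⌈((Fintype.card T.Leaf : ℝ) - 1) / ((qbar : ℝ) - 1)⌉ ≤ (Fintype.card T.Node : ℤ) ∧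
        γ₀ ^ (((Fintype.card T.Leaf : ℝ) - 1) / ((qbar : ℝ) - 1)) ≤
          ConnTensor.quantumMax.{u} T.tensor y / T.tensor.classicalMax y) := by
  refine ⟨fun P hP => abs_le.1 (T.isConnector_tensor.abs_value_le_one y hP),
    (hT.exists_isQuantum_value_eq y).1, (hT.exists_isQuantum_value_eq y).2,
    T.isGreatest_gamma_complexAt y,
    fun P hP => abs_le.1 (T.abs_value_le_of_isClassical y hP), fun γ₀ hγ₀ hγ => ?_⟩
  have hpos : 0 < γ₀ := zero_lt_one.trans hγ₀
  have hpow : γ₀ ^ Fintype.card T.Node ≤ T.bigGamma := Network.pow_card_node_le_bigGamma hpos.le hγ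
  have hratio := hpow.trans (hT.bigGamma_le_quantumMax_div_classicalMax y)
  refine ⟨(T.classicalMax_le_inv_bigGamma y).trans (inv_anti₀ (pow_pos hpos _) hpow), hratio,
    fun qbar hqbar hq => ?_⟩
  have hcard := Network.card_leaf_sub_one_div_le hqbar hq
  refine ⟨Int.ceil_le.2 (by exact_mod_cast hcard), le_trans ?_ hratio⟩
  rw [← Real.rpow_natCast]
  exact Real.rpow_le_rpow_of_exponent_le hγ₀.le hcard
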